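/- Consider on the Heisenberg group $H^1=\mathbb{R}^3$, with coordinates $(x,y,t)$, the equation $\Delta_{H^1}u+u=0$, where $$\Delta_{H^1}=\partial_x^2+\partial_y^2+4(x^2+y^2)\partial_t^2+4y\,\partial_x\partial_t-4x\,\partial_y\partial_t ,$$ with Lagrangian $$\mathcal L=\tfrac12u_x^2+\tfrac12u_y^2+2(x^2+y^2)u_t^2+2y\,u_xu_t-2x\,u_yu_t-F(u),\qquad F'(u)=u .$$ A Lie point symmetry is a smooth vector field $S=\xi^i(x,y,t,u)\,\partial_{x^i}+\eta(x,y,t,u)\,\partial_u$ on $H^1\times\mathbb{R}$ whose second-order extension satisfies $S^{(2)}(\Delta_{H^1}u+u)=0$ at all points of jet space where $\Delta_{H^1}u+u=0$. It is a Noether symmetry if in addition $$S^{(1)}\mathcal L+\mathcal L\,D_i\xi^i=D_i\varphi^i$$ holds on jet space for some smooth functions $\varphi^1,\varphi^2,\varphi^3$ of the point $(x,y,t)$, of $u$ and of finitely many derivatives of $u$, where $D_i$ is the total derivative. Then the Noether symmetries form a Lie algebra of vector fields, and this Lie algebra is exactly the real linear span of $$T=\partial_t,\quad R=y\,\partial_x-x\,\partial_y,\quad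 \tilde X=\partial_x-2y\,\partial_t,\quad \tilde Y=\partial_y+2x\,\partial_t$$ and of all the fields $W_\beta=\beta(x,y,t)\,\partial_u$ with $\beta$ a smooth solution on $H^1$ of $\Delta_{H^1}\beta+\beta=0$. The field $U=u\,\partial_u$ is a Lie point symmetry of the equation, but it is not a Noether symmetry. -/

import Mathlib

open scoped ContDiff

noncomputable section

namespace KohnLaplace

/-- The underlying manifold `ℝ³` of the Heisenberg group `H¹`; the coordinates `x`, `y`, `t` of a
point `p` are `p 0`, `p 1`, `p 2`. -/
abbrev H1 : Type := Fin 3 → ℝ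

/-- Multi-indices of partial derivatives in the variables `x`, `y`, `t`. -/
abbrev MultiIndex : Type := Fin 3 → ℕ

/-- The space of all jets of functions `u : H¹ → ℝ`. For a jet `z`, `z.1` is the base point and
`z.2 α` is the coordinate `u_α`; in particular `z.2 0` is the coordinate `u`. -/
abbrev Jet : Type := H1 × (MultiIndex → ℝ)

/-- The multi-index of the partial derivative with respect to the `i`-th variable. -/
def e (i : Fin 3) : MultiIndex := Pi.single i 1

/-- The partial derivative `∂β/∂xⁱ` of a function on `H¹`. -/
def pd (i : Fin 3) (β : H1 → ℝ) (p : H1) : ℝ :=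
  deriv (fun s => β (Function.update p i s)) (p i)

/-- The partial derivative `∂G/∂xⁱ` of a function on jet space, all jet coordinates being fixed. -/
def jetDx (i : Fin 3) (G : Jet → ℝ) (z : Jet) : ℝ :=
  deriv (fun s => G (Function.update z.1 i s, z.2)) (z.1 i)

/-- The partial derivative `∂G/∂u_α` of a function on jet space. -/
def jetDu (α : MultiIndex) (G : Jet → ℝ) (z : Jet) : ℝ :=
  deriv (fun s => G (z.1, Function.update z.2 α s)) (z.2 α)

/-- The total derivative
`D_i = ∂/∂xⁱ + u_i ∂/∂u + u_{ij} ∂/∂u_j + ⋯ = ∂/∂xⁱ + ∑_α u_{α+e_i} ∂/∂u_α`.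
It is applied to functions that depend on finitely many jet coordinates only, for which the sum
has finitely many non-zero terms. -/
def totalD (i : Fin 3) (G : Jet → ℝ) (z : Jet) : ℝ :=
  jetDx i G z + ∑ᶠ α : MultiIndex, z.2 (α + e i) * jetDu α G z

/-- Differential functions: smooth functions of the base point and of finitely many of the jet
coordinates (of arbitrary order). -/
def IsDifferentialFunction (G : Jet → ℝ) : Prop :=
  ∃ (A : Finset MultiIndex) (g : H1 × (A → ℝ) → ℝ),
    ContDiff ℝ ∞ g ∧ ∀ z : Jet, G z = g (z.1, fun α => z.2 α)

/-- Vector fields `S = ξⁱ(x,u) ∂/∂xⁱ + η(x,u) ∂/∂u` on `H¹ × ℝ`, as the maps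
`(x, u) ↦ (ξ(x,u), η(x,u))`. -/
abbrev PointField : Type := H1 × ℝ → H1 × ℝ

/-- The coefficient `ξⁱ` as a function on jet space. -/
def xi (S : PointField) (i : Fin 3) (z : Jet) : ℝ := (S (z.1, z.2 0)).1 i

/-- The coefficient `η` as a function on jet space. -/
def eta (S : PointField) (z : Jet) : ℝ := (S (z.1, z.2 0)).2

/-- The multi-index `e_{i₁} + ⋯ + e_{i_j}` of a list of variables. -/
def multiIndexOf (I : List (Fin 3)) : MultiIndex := (I.map e).sum

/-- The coefficients of the extended vector field, the most recently added index being the head of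
the list:
`η_i = D_i η - (D_i ξˡ) u_l` and `η_{I i} = D_i η_I - (D_i ξˡ) u_{I l}`. -/
def etaExt (S : PointField) : List (Fin 3) → Jet → ℝ
  | [] => eta S
  | i :: I => fun z =>
      totalD i (etaExt S I) z - ∑ l : Fin 3, totalD i (xi S l) z * z.2 (multiIndexOf I + e l)

/-- The list of variables that belongs to a multi-index, in the order `x ⋯ x y ⋯ y t ⋯ t`. -/
def indexList (α : MultiIndex) : List (Fin 3) :=
  List.replicate (α 0) 0 ++ List.replicate (α 1) 1 ++ List.replicate (α 2) 2

/-- The `k`-th order extension `S⁽ᵏ⁾`, applied to a function on jet space: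
`S⁽ᵏ⁾ G = ξⁱ ∂G/∂xⁱ + ∑_{m ≤ k} ∑_{|α| = m} η_α ∂G/∂u_α`. -/
def extend (k : ℕ) (S : PointField) (G : Jet → ℝ) (z : Jet) : ℝ :=
  ∑ i : Fin 3, xi S i z * jetDx i G z +
    ∑ m ∈ Finset.range (k + 1), ∑ α ∈ Finset.Nat.antidiagonalTuple 3 m,
      etaExt S (indexList α) z * jetDu α G z

/-- `S` is a Lie point symmetry of the equation `E = 0` of order `k`: it is a smooth vector field
with `S⁽ᵏ⁾ E = 0` wherever `E = 0`. -/
def IsLiePointSymmetry (k : ℕ) (E : Jet → ℝ) (S : PointField) : Prop :=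
  ContDiff ℝ ∞ S ∧ ∀ z : Jet, E z = 0 → extend k S E z = 0

/-- `S` is a Noether symmetry of the equation `E = 0` of order `k` with Lagrangian `L` of
order `l`: it is a Lie point symmetry of `E = 0` and `S⁽ˡ⁾ L + L D_i ξⁱ = D_i φⁱ` holds on jet
space for some differential functions `φ¹, φ², φ³`. -/
def IsNoetherSymmetry (k : ℕ) (E : Jet → ℝ) (l : ℕ) (L : Jet → ℝ) (S : PointField) : Prop :=
  IsLiePointSymmetry k E S ∧
    ∃ φ : Fin 3 → Jet → ℝ, (∀ i, IsDifferentialFunction (φ i)) ∧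
      ∀ z : Jet, extend l S L z + L z * ∑ i : Fin 3, totalD i (xi S i) z
        = ∑ i : Fin 3, totalD i (φ i) z

/-- The Kohn-Laplace operator
`Δβ = β_xx + β_yy + 4(x² + y²) β_tt + 4y β_xt - 4x β_yt` on functions on `H¹`. -/
def kohnLaplacian (β : H1 → ℝ) (p : H1) : ℝ :=
  pd 0 (pd 0 β) p + pd 1 (pd 1 β) p + 4 * (p 0 ^ 2 + p 1 ^ 2) * pd 2 (pd 2 β) p
    + 4 * p 1 * pd 0 (pd 2 β) p - 4 * p 0 * pd 1 (pd 2 β) p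

/-- The left-hand side `Δu + f(u)` of the semilinear Kohn-Laplace equation, as a function on jet
space. -/
def klEquation (f : ℝ → ℝ) (z : Jet) : ℝ :=
  z.2 (e 0 + e 0) + z.2 (e 1 + e 1) + 4 * (z.1 0 ^ 2 + z.1 1 ^ 2) * z.2 (e 2 + e 2)
    + 4 * z.1 1 * z.2 (e 0 + e 2) - 4 * z.1 0 * z.2 (e 1 + e 2) + f (z.2 0)

/-- The Lagrangian
`½ u_x² + ½ u_y² + 2(x² + y²) u_t² + 2y u_x u_t - 2x u_y u_t - F(u)`, where `F' = f`. -/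
def klLagrangian (F : ℝ → ℝ) (z : Jet) : ℝ :=
  1 / 2 * z.2 (e 0) ^ 2 + 1 / 2 * z.2 (e 1) ^ 2
    + 2 * (z.1 0 ^ 2 + z.1 1 ^ 2) * z.2 (e 2) ^ 2
    + 2 * z.1 1 * z.2 (e 0) * z.2 (e 2) - 2 * z.1 0 * z.2 (e 1) * z.2 (e 2) - F (z.2 0)

/-- `T = ∂/∂t`. -/
def fieldT : PointField := fun _ => (![0, 0, 1], 0)

/-- `R = y ∂/∂x - x ∂/∂y`. -/
def fieldR : PointField := fun q => (![q.1 1, -q.1 0, 0], 0)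

/-- `X̃ = ∂/∂x - 2y ∂/∂t`. -/
def fieldX : PointField := fun q => (![1, 0, -2 * q.1 1], 0)

/-- `Ỹ = ∂/∂y + 2x ∂/∂t`. -/
def fieldY : PointField := fun q => (![0, 1, 2 * q.1 0], 0)

/-- `U = u ∂/∂u`. -/
def fieldU : PointField := fun q => (0, q.2)

/-- `W_β = β(x,y,t) ∂/∂u`. -/
def fieldW (β : H1 → ℝ) : PointField := fun q => (0, β q.1)

/-- The set `G_f = {T, R, X̃, Ỹ}`. -/
def Gf : Set PointField := {fieldT, fieldR, fieldX, fieldY}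

/-- The fields `W_β`, where `β` is a smooth solution of `Δβ + β = 0`. -/
def linearW : Set PointField :=
  {S | ∃ β : H1 → ℝ, ContDiff ℝ ∞ β ∧ (∀ p, kohnLaplacian β p + β p = 0) ∧ S = fieldW β}

end KohnLaplace

end

/-! In the left-invariant frame X = ∂_x + 2y ∂_t, Y = ∂_y - 2x ∂_t, with [X, Y] = -4 ∂_t, the
operator is X² + Y². On the equation u_xx can be eliminated; S⁽²⁾(Δu + u) is then a polynomial in
the free jet coordinates, and the vanishing of its coefficients gives `DeterminingEquations`: ξ does
not depend on u, η is affine in u, and ξ is an infinitesimal conformal contact transformation of H¹.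

Let k = 2 X(ξ⁰) be its conformal factor. The commutator relations alone force Δk = 0, while the
zero-order term u of the equation forces Δk = 2k. Hence k = 0 (`DeterminingEquations.dHX_xi_zero`),
which excludes dilations and inversions, and the Lie point symmetries are a T + r R + b X̃ + c Ỹ + m
U + W_β (`DeterminingEquations.exists_eq`).

For such a field the Noether expression equals m (|∇u|² - u²) plus the divergence of u∇β, with ∇ the
horizontal gradient (`extend_one_symField`). So everything with m = 0 is a Noether symmetry, and m ≠
0 would make |∇u|² - u² a total divergence. It is none (`quadLagrangian_not_divergence`): the
integral of a divergence over a box is the same for all functions vanishing near the boundary, hence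
that of the zero function, but |∇(v cos x)|² + |∇(v sin x)|² = |∇v|² + v² yields a combination of
such integrals equal to ∫ v² > 0.

The bracket closes because T, R, X̃, Ỹ span a Lie algebra of fields commuting with Δ
(`lieBracket_symField`, `lap_along_killing`). -/

noncomputable section

namespace KohnLaplace

/-! ### Smooth functions on H¹ × ℝ as a differential ring -/

/-- The algebra of smooth functions on `H¹ × ℝ`. -/
def Sm : Subalgebra ℝ (H1 × ℝ → ℝ) where
  carrier := {g | ContDiff ℝ ∞ g}
  mul_mem' {a b} (ha : ContDiff ℝ ∞ a) (hb : ContDiff ℝ ∞ b) := ha.mul hb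
  add_mem' {a b} (ha : ContDiff ℝ ∞ a) (hb : ContDiff ℝ ∞ b) := ha.add hb
  algebraMap_mem' c := (contDiff_const : ContDiff ℝ ∞ fun _ : H1 × ℝ => c)

lemma Sm.contDiff (a : Sm) : ContDiff ℝ ∞ (a : H1 × ℝ → ℝ) := a.2

lemma Sm.differentiable (a : Sm) : Differentiable ℝ (a : H1 × ℝ → ℝ) :=
  (Sm.contDiff a).differentiable (by simp)

/-- The directional derivative of smooth functions on `H¹ × ℝ`. -/
def dirD (v : H1 × ℝ) : Derivation ℝ Sm Sm :=
  Derivation.mk'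
    { toFun := fun a => ⟨fun q => fderiv ℝ (a : H1 × ℝ → ℝ) q v,
        (((Sm.contDiff a).fderiv_right (m := ∞) (by simp)).clm_apply contDiff_const :
          ContDiff ℝ ∞ fun q => fderiv ℝ (a : H1 × ℝ → ℝ) q v)⟩
      map_add' := fun a b => by
        ext q
        change fderiv ℝ ((a : H1 × ℝ → ℝ) + (b : H1 × ℝ → ℝ)) q v
          = fderiv ℝ a q v + fderiv ℝ (b : H1 × ℝ → ℝ) q v
        rw [fderiv_add ((Sm.differentiable a) q) ((Sm.differentiable b) q)]
        rfl
      map_smul' := fun c a => by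
        ext q
        change fderiv ℝ (c • (a : H1 × ℝ → ℝ)) q v = c * fderiv ℝ a q v
        rw [fderiv_const_smul ((Sm.differentiable a) q)]
        rfl }
    fun a b => by
      ext q
      change fderiv ℝ ((a : H1 × ℝ → ℝ) * (b : H1 × ℝ → ℝ)) q v
        = a.1 q * fderiv ℝ (b : H1 × ℝ → ℝ) q v + b.1 q * fderiv ℝ a q v
      rw [fderiv_mul ((Sm.differentiable a) q) ((Sm.differentiable b) q)]
      rfl

lemma dirD_comm (v w : H1 × ℝ) (a : Sm) : dirD v (dirD w a) = dirD w (dirD v a) := by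
  have key : ∀ (v w q : H1 × ℝ), (dirD v (dirD w a) : H1 × ℝ → ℝ) q
      = fderiv ℝ (fderiv ℝ (a : H1 × ℝ → ℝ)) q v w := by
    intro v w q
    have hd : DifferentiableAt ℝ (fderiv ℝ (a : H1 × ℝ → ℝ)) q :=
      ((Sm.contDiff a).fderiv_right (m := ∞) (by simp)).differentiable (by simp) q
    change fderiv ℝ (fun q => fderiv ℝ (a : H1 × ℝ → ℝ) q w) q v = _
    rw [fderiv_clm_apply hd (differentiableAt_const w)]
    simp
  ext q
  rw [key, key]
  exact ((Sm.contDiff a).contDiffAt.isSymmSndFDerivAt 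
    (by simpa using (WithTop.coe_le_coe.2 le_top : ((2 : ℕ∞) : WithTop ℕ∞) ≤ ∞))).eq v w

/-- The partial derivative in the `i`-th variable of `H¹`. -/
def dX (i : Fin 3) : Derivation ℝ Sm Sm := dirD (Pi.single i 1, 0)

/-- The partial derivative in the dependent variable. -/
def dU : Derivation ℝ Sm Sm := dirD (0, 1)

lemma dX_comm (i j : Fin 3) (a : Sm) : dX i (dX j a) = dX j (dX i a) := dirD_comm _ _ _

lemma dU_dX (i : Fin 3) (a : Sm) : dU (dX i a) = dX i (dU a) := dirD_comm _ _ _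

lemma Sm.hasDerivAt_update (a : Sm) (i : Fin 3) (p : H1) (u : ℝ) :
    HasDerivAt (fun s => (a : H1 × ℝ → ℝ) (Function.update p i s, u)) ((dX i a : H1 × ℝ → ℝ) (p, u))
      (p i) := by
  have h1 : HasDerivAt (fun s => (Function.update p i s, u)) ((Pi.single i 1 : H1), (0 : ℝ)) (p i) :=
    (_root_.hasDerivAt_update p i (p i)).prodMk (hasDerivAt_const _ _)
  have h2 := ((Sm.differentiable a) (p, u)).hasFDerivAt
  exact HasFDerivAt.comp_hasDerivAt_of_eq (p i) h2 h1 (by simp)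

lemma Sm.hasDerivAt_snd (a : Sm) (p : H1) (u : ℝ) :
    HasDerivAt (fun s => (a : H1 × ℝ → ℝ) (p, s)) ((dU a : H1 × ℝ → ℝ) (p, u)) u := by
  have h1 : HasDerivAt (fun s : ℝ => (p, s)) ((0 : H1), (1 : ℝ)) u :=
    (hasDerivAt_const _ _).prodMk (hasDerivAt_id _)
  exact HasFDerivAt.comp_hasDerivAt u ((Sm.differentiable a) (p, u)).hasFDerivAt h1

lemma Sm.fderiv_apply (a : Sm) (q : H1 × ℝ) (v : H1) (w : ℝ) :
    fderiv ℝ (a : H1 × ℝ → ℝ) q (v, w)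
      = v 0 * (dX 0 a : H1 × ℝ → ℝ) q + v 1 * (dX 1 a : H1 × ℝ → ℝ) q
        + v 2 * (dX 2 a : H1 × ℝ → ℝ) q + w * (dU a : H1 × ℝ → ℝ) q := by
  have : ((v, w) : H1 × ℝ) = v 0 • ((Pi.single 0 1 : H1), (0 : ℝ)) + v 1 • ((Pi.single 1 1 : H1), (0 : ℝ))
      + v 2 • ((Pi.single 2 1 : H1), (0 : ℝ)) + w • ((0 : H1), (1 : ℝ)) := by
    ext i
    · fin_cases i <;> simp
    · simp
  rw [this]
  simp only [map_add, map_smul, smul_eq_mul]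
  rfl

lemma Sm.eq_const (a : Sm) (h : ∀ i, dX i a = 0) (hu : dU a = 0) :
    ∃ c : ℝ, a = algebraMap ℝ Sm c := by
  refine ⟨(a : H1 × ℝ → ℝ) 0, ?_⟩
  ext q
  refine is_const_of_fderiv_eq_zero (Sm.differentiable a) (fun q => ?_) q 0
  ext v
  · simp [Sm.fderiv_apply, h, hu]
  · simp [Sm.fderiv_apply, h, hu]

/-- The coordinate functions of `H¹`. -/
def co (i : Fin 3) : Sm := ⟨fun q => q.1 i, by
  change ContDiff ℝ ∞ (fun q : H1 × ℝ => q.1 i)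
  fun_prop⟩

/-- The dependent variable as a function on `H¹ × ℝ`. -/
def uu : Sm := ⟨fun q => q.2, (contDiff_snd : ContDiff ℝ ∞ fun q : H1 × ℝ => q.2)⟩

@[simp] lemma co_apply (i : Fin 3) (q : H1 × ℝ) : (co i : H1 × ℝ → ℝ) q = q.1 i := rfl

@[simp] lemma uu_apply (q : H1 × ℝ) : (uu : H1 × ℝ → ℝ) q = q.2 := rfl

@[simp] lemma dX_co (i j : Fin 3) : dX i (co j) = if i = j then 1 else 0 := by
  ext q
  have h : HasDerivAt (fun s => Function.update q.1 i s j) ((Pi.single i 1 : H1) j) (q.1 i) :=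
    (hasDerivAt_pi.1 (_root_.hasDerivAt_update q.1 i (q.1 i))) j
  rw [((Sm.hasDerivAt_update (co j)) i q.1 q.2).unique h]
  by_cases hij : i = j
  · subst hij; simp
  · rw [Pi.single_eq_of_ne (Ne.symm hij)]; simp [hij]

@[simp] lemma dU_co (j : Fin 3) : dU (co j) = 0 := by
  ext q
  exact ((Sm.hasDerivAt_snd (co j)) q.1 q.2).unique (hasDerivAt_const _ _)

@[simp] lemma dX_uu (i : Fin 3) : dX i uu = 0 := by
  ext q
  exact ((Sm.hasDerivAt_update uu) i q.1 q.2).unique (hasDerivAt_const _ _)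

@[simp] lemma dU_uu : dU uu = 1 := by
  ext q
  exact ((Sm.hasDerivAt_snd uu) q.1 q.2).unique (hasDerivAt_id _)

/-! ### Differential functions and the total derivative -/

/-- Lets two differential functions be written over a common finite set of jet coordinates. -/
lemma IsDifferentialFunction.mono {G : Jet → ℝ} {A B : Finset MultiIndex} (hAB : A ⊆ B)
    {g : H1 × (A → ℝ) → ℝ} (hg : ContDiff ℝ ∞ g) (h : ∀ z : Jet, G z = g (z.1, fun α => z.2 α)) :
    ∃ g' : H1 × (B → ℝ) → ℝ, ContDiff ℝ ∞ g' ∧ ∀ z : Jet, G z = g' (z.1, fun α => z.2 α) :=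
  ⟨fun q => g (q.1, fun α => q.2 ⟨α, hAB α.2⟩), hg.comp (by fun_prop), fun z => h z⟩

lemma IsDifferentialFunction.map₂ {G K : Jet → ℝ} (hG : IsDifferentialFunction G)
    (hK : IsDifferentialFunction K) {m : ℝ → ℝ → ℝ} (hm : ContDiff ℝ ∞ fun q : ℝ × ℝ => m q.1 q.2) :
    IsDifferentialFunction fun z => m (G z) (K z) := by
  classical
  obtain ⟨A, g, hg, hgG⟩ := hG
  obtain ⟨B, k, hk, hkK⟩ := hK
  obtain ⟨g', hg', hg'G⟩ := IsDifferentialFunction.mono Finset.subset_union_left hg hgG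
  obtain ⟨k', hk', hk'K⟩ := IsDifferentialFunction.mono Finset.subset_union_right hk hkK
  exact ⟨A ∪ B, fun q => m (g' q) (k' q), hm.comp (hg'.prodMk hk'),
    fun z => congrArg₂ m (hg'G z) (hk'K z)⟩

/-- The algebra of differential functions. -/
def DF : Subalgebra ℝ (Jet → ℝ) where
  carrier := {G | IsDifferentialFunction G}
  mul_mem' := fun ha hb => ha.map₂ hb (m := fun x y => x * y) (by fun_prop)
  add_mem' := fun ha hb => ha.map₂ hb (m := fun x y => x + y) (by fun_prop)
  algebraMap_mem' := fun c => ⟨∅, fun _ => c, contDiff_const, fun _ => rfl⟩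

lemma IsDifferentialFunction.differentiableAt_update_fst {G : Jet → ℝ}
    (hG : IsDifferentialFunction G) (i : Fin 3) (z : Jet) :
    DifferentiableAt ℝ (fun s => G (Function.update z.1 i s, z.2)) (z.1 i) := by
  obtain ⟨A, g, hg, hgG⟩ := hG
  simp only [hgG]
  have h1 : DifferentiableAt ℝ (fun s => (Function.update z.1 i s, fun α : A => z.2 α)) (z.1 i) :=
    (hasDerivAt_update z.1 i (z.1 i)).differentiableAt.prodMk (differentiableAt_const _)
  exact (hg.differentiable (by simp) _).comp (z.1 i) h1

lemma differentiableAt_update_apply (z : MultiIndex → ℝ) (α β : MultiIndex) (s : ℝ) :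
    DifferentiableAt ℝ (fun s => Function.update z α s β) s := by
  by_cases h : β = α
  · subst h; simp
  · simp [Function.update_of_ne h]

lemma IsDifferentialFunction.differentiableAt_update_snd {G : Jet → ℝ}
    (hG : IsDifferentialFunction G) (α : MultiIndex) (z : Jet) :
    DifferentiableAt ℝ (fun s => G (z.1, Function.update z.2 α s)) (z.2 α) := by
  obtain ⟨A, g, hg, hgG⟩ := hG
  simp only [hgG]
  have h1 : DifferentiableAt ℝ (fun s => (z.1, fun β : A => Function.update z.2 α s β)) (z.2 α) :=
    (differentiableAt_const _).prodMk
      (differentiableAt_pi.2 fun β => differentiableAt_update_apply _ _ _ _)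
  exact (hg.differentiable (by simp) _).comp (z.2 α) h1

/-- A `finsum` with infinite support has the default value 0, so the additivity and the Leibniz rule
of `totalD` rest on this finiteness. -/
lemma IsDifferentialFunction.finite_support {G : Jet → ℝ} (hG : IsDifferentialFunction G)
    (c : MultiIndex → ℝ) (z : Jet) :
    Function.HasFiniteSupport fun α => c α * jetDu α G z := by
  obtain ⟨A, g, hg, hgG⟩ := hG
  change (Function.support _).Finite
  refine A.finite_toSet.subset fun α hα => ?_
  by_contra hA
  apply hα
  have : (fun s => G (z.1, Function.update z.2 α s)) = fun _ => G z := by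
    funext s
    rw [hgG, hgG]
    congr 2
    funext β
    refine Function.update_of_ne ?_ _ _
    rintro rfl
    exact hA β.2
  simp [jetDu, this]

/-- The total derivative as a derivation on differential functions. -/
def TD (i : Fin 3) : Derivation ℝ DF (Jet → ℝ) :=
  Derivation.mk'
    { toFun := fun G => totalD i G
      map_add' := fun G K => by
        funext z
        have hx : jetDx i (G + K : DF) z = jetDx i G z + jetDx i K z :=
          deriv_add (G.2.differentiableAt_update_fst i z) (K.2.differentiableAt_update_fst i z)
        have hu : ∀ α, jetDu α (G + K : DF) z = jetDu α G z + jetDu α K z := fun α =>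
          deriv_add (G.2.differentiableAt_update_snd α z) (K.2.differentiableAt_update_snd α z)
        simp only [Pi.add_apply, totalD, hx, hu, mul_add]
        rw [finsum_add_distrib (G.2.finite_support _ z) (K.2.finite_support _ z)]
        ring
      map_smul' := fun c G => by
        funext z
        have hx : jetDx i (c • G : DF) z = c * jetDx i G z :=
          deriv_const_mul _ (G.2.differentiableAt_update_fst i z)
        have hu : ∀ α, jetDu α (c • G : DF) z = c * jetDu α G z := fun α =>
          deriv_const_mul _ (G.2.differentiableAt_update_snd α z)
        simp only [Pi.smul_apply, totalD, hx, hu, smul_eq_mul, RingHom.id_apply, mul_add,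
          mul_finsum, mul_left_comm c] }
    fun G K => by
      funext z
      have hx : jetDx i (G * K : DF) z = G.1 z * jetDx i K z + K.1 z * jetDx i G z := by
        have := deriv_mul (G.2.differentiableAt_update_fst i z) (K.2.differentiableAt_update_fst i z)
        refine this.trans ?_
        simp only [Function.update_eq_self, jetDx]
        ring
      have hu : ∀ α, jetDu α (G * K : DF) z = G.1 z * jetDu α K z + K.1 z * jetDu α G z := by
        intro α
        have := deriv_mul (G.2.differentiableAt_update_snd α z) (K.2.differentiableAt_update_snd α z)
        refine this.trans ?_
        simp only [Function.update_eq_self, jetDu]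
        ring
      change totalD i (G * K : DF) z = G.1 z * totalD i K z + K.1 z * totalD i G z
      simp only [totalD, hx, hu, mul_add, mul_finsum, mul_left_comm _ (G.1 z), mul_left_comm _ (K.1 z)]
      rw [finsum_add_distrib, ← mul_finsum, ← mul_finsum]
      · ring
      · simpa only [mul_assoc] using K.2.finite_support (fun α => G.1 z * z.2 (α + e i)) z
      · simpa only [mul_assoc] using G.2.finite_support (fun α => K.1 z * z.2 (α + e i)) z

lemma TD_apply (i : Fin 3) (G : DF) : TD i G = totalD i G := rfl

/-- The jet coordinate `u_α` as a differential function. -/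
def jc (α : MultiIndex) : DF :=
  ⟨fun z => z.2 α, {α}, fun q => q.2 ⟨α, Finset.mem_singleton_self α⟩, by fun_prop, fun _ => rfl⟩

/-- A smooth function on `H¹ × ℝ` as a differential function. -/
def pt : Sm →ₐ[ℝ] DF where
  toFun a := ⟨fun z => a.1 (z.1, z.2 0), {0},
    fun q => a.1 (q.1, q.2 ⟨0, Finset.mem_singleton_self 0⟩), (Sm.contDiff a).comp (by fun_prop),
    fun _ => rfl⟩
  map_one' := rfl
  map_mul' _ _ := rfl
  map_zero' := rfl
  map_add' _ _ := rfl
  commutes' _ := rfl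

@[simp] lemma jc_apply (α : MultiIndex) (z : Jet) : (jc α : Jet → ℝ) z = z.2 α := rfl

@[simp] lemma pt_apply (a : Sm) (z : Jet) : (pt a : Jet → ℝ) z = a.1 (z.1, z.2 0) := rfl

@[simp] lemma TD_jc (i : Fin 3) (α : MultiIndex) : TD i (jc α) = jc (α + e i) := by
  funext z
  change jetDx i _ z + ∑ᶠ β : MultiIndex, z.2 (β + e i) * jetDu β _ z = z.2 (α + e i)
  have hx : jetDx i (jc α) z = 0 := deriv_const _ _
  have hu : ∀ β, jetDu β (jc α) z = if β = α then 1 else 0 := by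
    intro β
    by_cases h : β = α
    · subst h; simp [jetDu]
    · simp [jetDu, Function.update_of_ne (Ne.symm h), h]
  rw [hx, zero_add, finsum_eq_single _ α]
  · simp [hu]
  · intro β hβ; simp [hu, hβ]

@[simp] lemma TD_pt (i : Fin 3) (a : Sm) :
    TD i (pt a) = (pt (dX i a) + jc (e i) * pt (dU a) : DF) := by
  funext z
  change jetDx i _ z + ∑ᶠ β : MultiIndex, z.2 (β + e i) * jetDu β _ z
    = (dX i a).1 (z.1, z.2 0) + z.2 (e i) * (dU a).1 (z.1, z.2 0)
  have hx : jetDx i (pt a) z = (dX i a).1 (z.1, z.2 0) := ((Sm.hasDerivAt_update a) i _ _).deriv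
  have hu : ∀ β, jetDu β (pt a) z = if β = 0 then (dU a).1 (z.1, z.2 0) else 0 := by
    intro β
    by_cases h : β = 0
    · subst h; simpa [jetDu] using ((Sm.hasDerivAt_snd a) z.1 (z.2 0)).deriv
    · simp [jetDu, Function.update_of_ne (Ne.symm h), h]
  rw [hx, finsum_eq_single _ 0]
  · simp [hu]
  · intro β hβ; simp [hu, hβ]

/-! ### Extensions of point vector fields -/

/-- The point vector field with coefficients `ξ` and `η`. -/
def pointField (ξ : Fin 3 → Sm) (η : Sm) : PointField := fun q => (fun l => (ξ l).1 q, η.1 q)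

lemma contDiff_pointField (ξ : Fin 3 → Sm) (η : Sm) : ContDiff ℝ ∞ (pointField ξ η) :=
  (contDiff_pi.2 fun l => Sm.contDiff (ξ l)).prodMk (Sm.contDiff η)

lemma exists_eq_pointField {S : PointField} (h : ContDiff ℝ ∞ S) : ∃ ξ η, S = pointField ξ η :=
  ⟨fun l => ⟨fun q => (S q).1 l, contDiff_pi.1 h.fst l⟩, ⟨fun q => (S q).2, h.snd⟩, rfl⟩

lemma xi_pointField (ξ : Fin 3 → Sm) (η : Sm) (l : Fin 3) :
    xi (pointField ξ η) l = (pt (ξ l) : DF) := rfl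

lemma totalD_xi_pointField (ξ : Fin 3 → Sm) (η : Sm) (i l : Fin 3) :
    totalD i (xi (pointField ξ η) l) = (pt (dX i (ξ l)) + jc (e i) * pt (dU (ξ l)) : DF) :=
  TD_pt i (ξ l)

/-- The coefficient `η_j` of the extension of a point vector field. -/
def etaOne (ξ : Fin 3 → Sm) (η : Sm) (j : Fin 3) : DF :=
  pt (dX j η) + jc (e j) * pt (dU η)
    - ∑ l : Fin 3, (pt (dX j (ξ l)) + jc (e j) * pt (dU (ξ l))) * jc (e l)

lemma etaExt_singleton (ξ : Fin 3 → Sm) (η : Sm) (j : Fin 3) :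
    etaExt (pointField ξ η) [j] = etaOne ξ η j := by
  funext z
  change totalD j (pt η : DF) z - _ = _
  rw [← TD_apply, TD_pt]
  simp only [totalD_xi_pointField, multiIndexOf, Fin.sum_univ_three, etaOne]
  simp

lemma etaExt_pair (ξ : Fin 3 → Sm) (η : Sm) (i j : Fin 3) (z : Jet) :
    etaExt (pointField ξ η) [i, j] z = TD i (etaOne ξ η j) z
      - ∑ l : Fin 3, ((dX i (ξ l)).1 (z.1, z.2 0) + z.2 (e i) * (dU (ξ l)).1 (z.1, z.2 0))
          * z.2 (e j + e l) := by
  change totalD i (etaExt (pointField ξ η) [j]) z - _ = _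
  rw [etaExt_singleton, ← TD_apply]
  simp only [totalD_xi_pointField, multiIndexOf]
  simp

/-- These three bring mixed second-order indices to the order x, y, t used in `klEquation` and
`testJet`. -/
lemma e_one_add_e_zero : e 1 + e 0 = e 0 + e 1 := add_comm _ _
lemma e_two_add_e_zero : e 2 + e 0 = e 0 + e 2 := add_comm _ _
lemma e_two_add_e_one : e 2 + e 1 = e 1 + e 2 := add_comm _ _

lemma TD_etaOne (ξ : Fin 3 → Sm) (η : Sm) (i j : Fin 3) (z : Jet) :
    TD i (etaOne ξ η j) z =
      (dX i (dX j η)).1 (z.1, z.2 0) + z.2 (e i) * (dX j (dU η)).1 (z.1, z.2 0)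
      + z.2 (e j) * (dX i (dU η)).1 (z.1, z.2 0)
      + z.2 (e i) * z.2 (e j) * (dU (dU η)).1 (z.1, z.2 0)
      + z.2 (e j + e i) * (dU η).1 (z.1, z.2 0)
      - ∑ l : Fin 3, (((dX i (dX j (ξ l))).1 (z.1, z.2 0)
            + z.2 (e i) * (dX j (dU (ξ l))).1 (z.1, z.2 0)
            + z.2 (e j) * (dX i (dU (ξ l))).1 (z.1, z.2 0)
            + z.2 (e i) * z.2 (e j) * (dU (dU (ξ l))).1 (z.1, z.2 0)
            + z.2 (e j + e i) * (dU (ξ l)).1 (z.1, z.2 0)) * z.2 (e l)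
          + ((dX j (ξ l)).1 (z.1, z.2 0) + z.2 (e j) * (dU (ξ l)).1 (z.1, z.2 0))
            * z.2 (e l + e i)) := by
  simp only [etaOne, Fin.sum_univ_three, map_add, map_sub, Derivation.leibniz, TD_pt, TD_jc, dU_dX]
  simp [Algebra.smul_def]
  ring

lemma sum_antidiagonalTuple_zero (f : MultiIndex → ℝ) :
    ∑ α ∈ Finset.Nat.antidiagonalTuple 3 0, f α = f 0 := by
  rw [show Finset.Nat.antidiagonalTuple 3 0 = {0} by decide, Finset.sum_singleton]

lemma sum_antidiagonalTuple_one (f : MultiIndex → ℝ) :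
    ∑ α ∈ Finset.Nat.antidiagonalTuple 3 1, f α = f (e 0) + f (e 1) + f (e 2) := by
  rw [show Finset.Nat.antidiagonalTuple 3 1 = {e 0, e 1, e 2} by decide,
    Finset.sum_insert (by decide), Finset.sum_insert (by decide), Finset.sum_singleton]
  ring

lemma sum_antidiagonalTuple_two (f : MultiIndex → ℝ) :
    ∑ α ∈ Finset.Nat.antidiagonalTuple 3 2, f α = f (e 0 + e 0) + f (e 0 + e 1) + f (e 0 + e 2)
      + f (e 1 + e 1) + f (e 1 + e 2) + f (e 2 + e 2) := by
  rw [show Finset.Nat.antidiagonalTuple 3 2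
      = {e 0 + e 0, e 0 + e 1, e 0 + e 2, e 1 + e 1, e 1 + e 2, e 2 + e 2} by decide,
    Finset.sum_insert (by decide), Finset.sum_insert (by decide), Finset.sum_insert (by decide),
    Finset.sum_insert (by decide), Finset.sum_insert (by decide), Finset.sum_singleton]
  ring

lemma extend_one (S : PointField) (G : Jet → ℝ) (z : Jet) :
    extend 1 S G z = ∑ i : Fin 3, xi S i z * jetDx i G z + eta S z * jetDu 0 G z
      + ∑ i : Fin 3, etaExt S [i] z * jetDu (e i) G z := by
  simp only [extend, Finset.sum_range_succ, Finset.sum_range_zero, sum_antidiagonalTuple_zero,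
    sum_antidiagonalTuple_one, Fin.sum_univ_three, zero_add]
  rw [show indexList 0 = [] from rfl, show indexList (e 0) = [0] from rfl,
    show indexList (e 1) = [1] from rfl, show indexList (e 2) = [2] from rfl]
  simp only [etaExt]
  ring

lemma extend_two (S : PointField) (G : Jet → ℝ) (z : Jet) :
    extend 2 S G z = extend 1 S G z
      + (etaExt S [0, 0] z * jetDu (e 0 + e 0) G z + etaExt S [0, 1] z * jetDu (e 0 + e 1) G z
        + etaExt S [0, 2] z * jetDu (e 0 + e 2) G z + etaExt S [1, 1] z * jetDu (e 1 + e 1) G z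
        + etaExt S [1, 2] z * jetDu (e 1 + e 2) G z
        + etaExt S [2, 2] z * jetDu (e 2 + e 2) G z) := by
  simp only [extend]
  rw [Finset.sum_range_succ _ 2, sum_antidiagonalTuple_two]
  rw [show indexList (e 0 + e 0) = [0, 0] from rfl, show indexList (e 0 + e 1) = [0, 1] from rfl,
    show indexList (e 0 + e 2) = [0, 2] from rfl, show indexList (e 1 + e 1) = [1, 1] from rfl,
    show indexList (e 1 + e 2) = [1, 2] from rfl, show indexList (e 2 + e 2) = [2, 2] from rfl]
  ring

/-! ### Partial derivatives of the equation and of the Lagrangian -/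

/-- Base coordinates and first derivatives enter the equation and the Lagrangian at most
quadratically. In the applications `c` is the value of the function with the coordinate in question
set to 0, which absorbs all other terms. -/
lemma deriv_of_quadratic {f : ℝ → ℝ} (a b c : ℝ) (h : ∀ s, f s = a * s ^ 2 + b * s + c) (s : ℝ) :
    deriv f s = 2 * a * s + b := by
  rw [funext h]
  have := (((hasDerivAt_pow 2 s).const_mul a).add ((hasDerivAt_id s).const_mul b)).add_const c
  refine (HasDerivAt.deriv this).trans ?_
  norm_num
  ring

section Equation

variable (z : Jet)

lemma jetDx_zero_klEquation : jetDx 0 (klEquation fun u => u) z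
    = 8 * z.1 0 * z.2 (e 2 + e 2) - 4 * z.2 (e 1 + e 2) := by
  refine (deriv_of_quadratic (4 * z.2 (e 2 + e 2)) (-4 * z.2 (e 1 + e 2))
    (klEquation (fun u => u) (Function.update z.1 0 0, z.2)) (fun s => ?_) _).trans ?_
  · simp (decide := true) [klEquation]
    ring
  · ring

lemma jetDx_one_klEquation : jetDx 1 (klEquation fun u => u) z
    = 8 * z.1 1 * z.2 (e 2 + e 2) + 4 * z.2 (e 0 + e 2) := by
  refine (deriv_of_quadratic (4 * z.2 (e 2 + e 2)) (4 * z.2 (e 0 + e 2))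
    (klEquation (fun u => u) (Function.update z.1 1 0, z.2)) (fun s => ?_) _).trans ?_
  · simp (decide := true) [klEquation]
    ring
  · ring

lemma jetDx_two_klEquation : jetDx 2 (klEquation fun u => u) z = 0 := by
  simp [jetDx, klEquation]

lemma jetDu_zero_klEquation : jetDu 0 (klEquation fun u => u) z = 1 := by
  simp (decide := true) [jetDu, klEquation]

lemma jetDu_e_klEquation (i : Fin 3) : jetDu (e i) (klEquation fun u => u) z = 0 := by
  fin_cases i <;> simp (decide := true) [jetDu, klEquation]

lemma jetDu_e00_klEquation : jetDu (e 0 + e 0) (klEquation fun u => u) z = 1 := by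
  simp (decide := true) [jetDu, klEquation]

lemma jetDu_e01_klEquation : jetDu (e 0 + e 1) (klEquation fun u => u) z = 0 := by
  simp (decide := true) [jetDu, klEquation]

lemma jetDu_e02_klEquation : jetDu (e 0 + e 2) (klEquation fun u => u) z = 4 * z.1 1 := by
  simp (decide := true) [jetDu, klEquation]

lemma jetDu_e11_klEquation : jetDu (e 1 + e 1) (klEquation fun u => u) z = 1 := by
  simp (decide := true) [jetDu, klEquation]

lemma jetDu_e12_klEquation : jetDu (e 1 + e 2) (klEquation fun u => u) z = -4 * z.1 0 := by
  simp (decide := true) [jetDu, klEquation]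

lemma jetDu_e22_klEquation :
    jetDu (e 2 + e 2) (klEquation fun u => u) z = 4 * (z.1 0 ^ 2 + z.1 1 ^ 2) := by
  simp (decide := true) [jetDu, klEquation]

variable {F : ℝ → ℝ}

lemma jetDx_zero_klLagrangian : jetDx 0 (klLagrangian F) z
    = 4 * z.1 0 * z.2 (e 2) ^ 2 - 2 * z.2 (e 1) * z.2 (e 2) := by
  refine (deriv_of_quadratic (2 * z.2 (e 2) ^ 2) (-2 * z.2 (e 1) * z.2 (e 2))
    (klLagrangian F (Function.update z.1 0 0, z.2)) (fun s => ?_) _).trans ?_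
  · simp (decide := true) [klLagrangian]
    ring
  · ring

lemma jetDx_one_klLagrangian : jetDx 1 (klLagrangian F) z
    = 4 * z.1 1 * z.2 (e 2) ^ 2 + 2 * z.2 (e 0) * z.2 (e 2) := by
  refine (deriv_of_quadratic (2 * z.2 (e 2) ^ 2) (2 * z.2 (e 0) * z.2 (e 2))
    (klLagrangian F (Function.update z.1 1 0, z.2)) (fun s => ?_) _).trans ?_
  · simp (decide := true) [klLagrangian]
    ring
  · ring

lemma jetDx_two_klLagrangian : jetDx 2 (klLagrangian F) z = 0 := by
  simp [jetDx, klLagrangian]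

lemma jetDu_zero_klLagrangian (hF : ∀ u : ℝ, HasDerivAt F u u) :
    jetDu 0 (klLagrangian F) z = -z.2 0 := by
  simp (decide := true) [jetDu, klLagrangian, (hF _).deriv]

lemma jetDu_e0_klLagrangian :
    jetDu (e 0) (klLagrangian F) z = z.2 (e 0) + 2 * z.1 1 * z.2 (e 2) := by
  refine (deriv_of_quadratic (1 / 2) (2 * z.1 1 * z.2 (e 2))
    (klLagrangian F (z.1, Function.update z.2 (e 0) 0)) (fun s => ?_) _).trans ?_
  · simp (decide := true) [klLagrangian]
    ring
  · ring

lemma jetDu_e1_klLagrangian :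
    jetDu (e 1) (klLagrangian F) z = z.2 (e 1) - 2 * z.1 0 * z.2 (e 2) := by
  refine (deriv_of_quadratic (1 / 2) (-2 * z.1 0 * z.2 (e 2))
    (klLagrangian F (z.1, Function.update z.2 (e 1) 0)) (fun s => ?_) _).trans ?_
  · simp (decide := true) [klLagrangian]
    ring
  · ring

lemma jetDu_e2_klLagrangian : jetDu (e 2) (klLagrangian F) z
    = 4 * (z.1 0 ^ 2 + z.1 1 ^ 2) * z.2 (e 2) + 2 * z.1 1 * z.2 (e 0) - 2 * z.1 0 * z.2 (e 1) := by
  refine (deriv_of_quadratic (2 * (z.1 0 ^ 2 + z.1 1 ^ 2)) (2 * z.1 1 * z.2 (e 0) - 2 * z.1 0 * z.2 (e 1))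
    (klLagrangian F (z.1, Function.update z.2 (e 2) 0)) (fun s => ?_) _).trans ?_
  · simp (decide := true) [klLagrangian]
    ring
  · ring

end Equation

/-! ### The left-invariant frame and the sum of squares -/

/-- The left-invariant field `∂_x + 2y ∂_t` as a derivation. -/
def dHX : Derivation ℝ Sm Sm := dX 0 + (2 * co 1) • dX 2

/-- The left-invariant field `∂_y - 2x ∂_t` as a derivation. -/
def dHY : Derivation ℝ Sm Sm := dX 1 - (2 * co 0) • dX 2

lemma dHX_eq (a : Sm) : dHX a = dX 0 a + 2 * co 1 * dX 2 a := rfl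

lemma dHY_eq (a : Sm) : dHY a = dX 1 a - 2 * co 0 * dX 2 a := rfl

@[simp] lemma derivation_two {M : Type*} [AddCommGroup M] [Module Sm M] [Module ℝ M]
    (D : Derivation ℝ Sm M) : D 2 = 0 := by
  exact_mod_cast D.map_natCast 2

@[simp] lemma derivation_four {M : Type*} [AddCommGroup M] [Module Sm M] [Module ℝ M]
    (D : Derivation ℝ Sm M) : D 4 = 0 := by
  exact_mod_cast D.map_natCast 4

/-- The only nontrivial commutator of the frame; all integrability conditions below come from it. -/
lemma dHX_dHY (a : Sm) : dHX (dHY a) = dHY (dHX a) - 4 * dX 2 a := by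
  simp only [dHX_eq, dHY_eq, map_add, map_sub, Derivation.leibniz, dX_co, smul_eq_mul,
    derivation_two, dX_comm 1 0 a, dX_comm 2 0 a, dX_comm 2 1 a]
  simp
  ring

lemma dHX_dX_two (a : Sm) : dHX (dX 2 a) = dX 2 (dHX a) := by
  simp only [dHX_eq, map_add, Derivation.leibniz, dX_co, smul_eq_mul, derivation_two, dX_comm 2 0 a]
  simp

lemma dHY_dX_two (a : Sm) : dHY (dX 2 a) = dX 2 (dHY a) := by
  simp only [dHY_eq, map_sub, Derivation.leibniz, dX_co, smul_eq_mul, derivation_two, dX_comm 2 1 a]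
  simp

lemma dHX_dU (a : Sm) : dHX (dU a) = dU (dHX a) := by
  simp only [dHX_eq, map_add, Derivation.leibniz, dU_co, smul_eq_mul, derivation_two, dU_dX]
  simp

lemma dHY_dU (a : Sm) : dHY (dU a) = dU (dHY a) := by
  simp only [dHY_eq, map_sub, Derivation.leibniz, dU_co, smul_eq_mul, derivation_two, dU_dX]
  simp

/-- The Kohn-Laplace operator on smooth functions of `(x, y, t, u)`. -/
def lap (a : Sm) : Sm :=
  dX 0 (dX 0 a) + dX 1 (dX 1 a) + 4 * (co 0 ^ 2 + co 1 ^ 2) * dX 2 (dX 2 a)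
    + 4 * co 1 * dX 0 (dX 2 a) - 4 * co 0 * dX 1 (dX 2 a)

/-- No first-order terms arise, since X annihilates y and Y annihilates x. -/
lemma lap_eq (a : Sm) : lap a = dHX (dHX a) + dHY (dHY a) := by
  simp only [lap, dHX_eq, dHY_eq, map_add, map_sub, Derivation.leibniz, dX_co, smul_eq_mul,
    derivation_two, dX_comm 2 0 a, dX_comm 2 1 a]
  simp
  ring

lemma lap_dU (a : Sm) : lap (dU a) = dU (lap a) := by
  simp only [lap_eq, map_add, dHX_dU, dHY_dU]

/-! ### The determining equations -/

/-- A jet of second order with prescribed coordinates. -/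
def testJet (p : H1) (u v0 v1 v2 m00 m01 m02 m11 m12 m22 : ℝ) : Jet :=
  (p, fun α => match α 0, α 1, α 2 with
    | 0, 0, 0 => u
    | 1, 0, 0 => v0
    | 0, 1, 0 => v1
    | 0, 0, 1 => v2
    | 2, 0, 0 => m00
    | 1, 1, 0 => m01
    | 1, 0, 1 => m02
    | 0, 2, 0 => m11
    | 0, 1, 1 => m12
    | 0, 0, 2 => m22
    | _, _, _ => 0)

section TestJet

variable (p : H1) (u v0 v1 v2 m00 m01 m02 m11 m12 m22 : ℝ)

local notation "J" => testJet p u v0 v1 v2 m00 m01 m02 m11 m12 m22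

lemma testJet_fst : (J).1 = p := rfl
lemma testJet_u : (J).2 0 = u := rfl
lemma testJet_v0 : (J).2 (e 0) = v0 := rfl
lemma testJet_v1 : (J).2 (e 1) = v1 := rfl
lemma testJet_v2 : (J).2 (e 2) = v2 := rfl
lemma testJet_m00 : (J).2 (e 0 + e 0) = m00 := rfl
lemma testJet_m01 : (J).2 (e 0 + e 1) = m01 := rfl
lemma testJet_m02 : (J).2 (e 0 + e 2) = m02 := rfl
lemma testJet_m11 : (J).2 (e 1 + e 1) = m11 := rfl
lemma testJet_m12 : (J).2 (e 1 + e 2) = m12 := rfl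
lemma testJet_m22 : (J).2 (e 2 + e 2) = m22 := rfl

end TestJet

/-- The second extension of a point vector field, applied to the Kohn-Laplace equation. -/
lemma extend_two_klEquation (ξ : Fin 3 → Sm) (η : Sm) (z : Jet) :
    extend 2 (pointField ξ η) (klEquation fun u => u) z =
      (ξ 0).1 (z.1, z.2 0) * (8 * z.1 0 * z.2 (e 2 + e 2) - 4 * z.2 (e 1 + e 2))
      + (ξ 1).1 (z.1, z.2 0) * (8 * z.1 1 * z.2 (e 2 + e 2) + 4 * z.2 (e 0 + e 2))
      + η.1 (z.1, z.2 0)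
      + (etaExt (pointField ξ η) [0, 0] z + etaExt (pointField ξ η) [1, 1] z
        + 4 * (z.1 0 ^ 2 + z.1 1 ^ 2) * etaExt (pointField ξ η) [2, 2] z
        + 4 * z.1 1 * etaExt (pointField ξ η) [0, 2] z
        - 4 * z.1 0 * etaExt (pointField ξ η) [1, 2] z) := by
  have hη : eta (pointField ξ η) z = η.1 (z.1, z.2 0) := rfl
  rw [extend_two, extend_one]
  simp only [Fin.sum_univ_three, jetDx_zero_klEquation, jetDx_one_klEquation, jetDx_two_klEquation,
    jetDu_zero_klEquation, jetDu_e_klEquation, jetDu_e00_klEquation, jetDu_e01_klEquation,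
    jetDu_e02_klEquation, jetDu_e11_klEquation, jetDu_e12_klEquation, jetDu_e22_klEquation,
    xi_pointField, pt_apply, hη]
  ring

/-- The condition `S⁽²⁾ E = 0` at the points of `E = 0`, in terms of the free jet coordinates. -/
lemma IsLiePointSymmetry.extend_testJet {ξ : Fin 3 → Sm} {η : Sm}
    (h : IsLiePointSymmetry 2 (klEquation fun u => u) (pointField ξ η)) (p : H1)
    (u v0 v1 v2 m01 m02 m11 m12 m22 : ℝ) :
    extend 2 (pointField ξ η) (klEquation fun u => u) (testJet p u v0 v1 v2
      -- The value of u_xx solved from the equation; all other coordinates stay free.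
      (-u - m11 - 4 * (p 0 ^ 2 + p 1 ^ 2) * m22 - 4 * p 1 * m02 + 4 * p 0 * m12)
      m01 m02 m11 m12 m22) = 0 := by
  apply h.2
  simp only [klEquation, testJet_fst, testJet_u, testJet_m00, testJet_m02,
    testJet_m11, testJet_m12, testJet_m22]
  ring

set_option maxHeartbeats 1600000 in
-- The derivatives ∂ξˡ/∂u occur in the coefficients of products of a first with a second derivative,
-- which mixed second differences of `key` isolate.
lemma IsLiePointSymmetry.dU_xi {ξ : Fin 3 → Sm} {η : Sm}
    (h : IsLiePointSymmetry 2 (klEquation fun u => u) (pointField ξ η)) :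
    ∀ l, dU (ξ l) = 0 := by
  have key := h.extend_testJet
  simp only [extend_two_klEquation, etaExt_pair, TD_etaOne, Fin.sum_univ_three, e_one_add_e_zero,
    e_two_add_e_zero, e_two_add_e_one, testJet_fst, testJet_u, testJet_v0, testJet_v1, testJet_v2,
    testJet_m00, testJet_m01, testJet_m02, testJet_m11, testJet_m12, testJet_m22] at key
  have h1 : ∀ p u, (dU (ξ 1)).1 (p, u) = 0 := fun p u => by
    linear_combination (-1 / 2) * (key p u 1 0 0 1 0 0 0 0 - key p u 1 0 0 0 0 0 0 0
      - key p u 0 0 0 1 0 0 0 0 + key p u 0 0 0 0 0 0 0 0)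
  have h0 : ∀ p u, (dU (ξ 0)).1 (p, u) = 0 := fun p u => by
    linear_combination (1 / 2) * (key p u 1 0 0 0 0 1 0 0 - key p u 1 0 0 0 0 0 0 0
      - key p u 0 0 0 0 0 1 0 0 + key p u 0 0 0 0 0 0 0 0)
  -- The eliminated u_xx also contains u_xt, whence the correction by `h0`.
  have h2 : ∀ p u, (dU (ξ 2)).1 (p, u) = 0 := fun p u => by
    linear_combination (-1 / 2) * (key p u 1 0 0 0 1 0 0 0 - key p u 1 0 0 0 0 0 0 0
      - key p u 0 0 0 0 1 0 0 0 + key p u 0 0 0 0 0 0 0 0) + 2 * p 1 * h0 p u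
  intro l
  ext ⟨p, u⟩
  fin_cases l
  · exact h0 p u
  · exact h1 p u
  · exact h2 p u

/-- The determining equations of the Lie point symmetries of `Δu + u = 0`. -/
structure DeterminingEquations (ξ : Fin 3 → Sm) (η : Sm) : Prop where
  dU_xi : ∀ l, dU (ξ l) = 0
  dU_dU_eta : dU (dU η) = 0
  -- Cauchy-Riemann type equations: ξ acts conformally on the horizontal metric.
  shear : dHX (ξ 1) + dHY (ξ 0) = 0
  stretch : dHX (ξ 0) = dHY (ξ 1)
  -- The function differentiated is the ∂_t-component of ξ in the frame X, Y, ∂_t. The two equations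
  -- say that ξ preserves the horizontal distribution.
  contactX : dHX (ξ 2 - 2 * co 1 * ξ 0 + 2 * co 0 * ξ 1) = 4 * ξ 1
  contactY : dHY (ξ 2 - 2 * co 1 * ξ 0 + 2 * co 0 * ξ 1) = -4 * ξ 0
  lap_xi_zero : lap (ξ 0) = 2 * dHX (dU η)
  lap_xi_one : lap (ξ 1) = 2 * dHY (dU η)
  lap_eta : lap η + η - uu * dU η + 2 * uu * dHX (ξ 0) = 0

set_option maxHeartbeats 1600000 in
lemma IsLiePointSymmetry.determiningEquations {ξ : Fin 3 → Sm} {η : Sm}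
    (h : IsLiePointSymmetry 2 (klEquation fun u => u) (pointField ξ η)) :
    DeterminingEquations ξ η := by
  have key := h.extend_testJet
  have hU := h.dU_xi
  have hz : ∀ q, ((0 : Sm) : H1 × ℝ → ℝ) q = 0 := fun _ => rfl
  simp only [extend_two_klEquation, etaExt_pair, TD_etaOne, Fin.sum_univ_three, e_one_add_e_zero,
    e_two_add_e_zero, e_two_add_e_one, testJet_fst, testJet_u, testJet_v0, testJet_v1, testJet_v2,
    testJet_m00, testJet_m01, testJet_m02, testJet_m11, testJet_m12, testJet_m22, hU, map_zero,
    hz, mul_zero, add_zero] at key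
  -- Differences in one second-order coordinate isolate its coefficient: u_xy here, u_yy in
  -- `hstretch`, u_xt and u_yt for the contact equations.
  have hshear : ∀ p u, (dX 0 (ξ 1)).1 (p, u) + 2 * p 1 * (dX 2 (ξ 1)).1 (p, u)
      + ((dX 1 (ξ 0)).1 (p, u) - 2 * p 0 * (dX 2 (ξ 0)).1 (p, u)) = 0 := fun p u => by
    linear_combination (-1 / 2) * (key p u 0 0 0 1 0 0 0 0 - key p u 0 0 0 0 0 0 0 0)
  have hstretch : ∀ p u, (dX 0 (ξ 0)).1 (p, u) + 2 * p 1 * (dX 2 (ξ 0)).1 (p, u)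
      = (dX 1 (ξ 1)).1 (p, u) - 2 * p 0 * (dX 2 (ξ 1)).1 (p, u) := fun p u => by
    linear_combination (1 / 2) * (key p u 0 0 0 0 0 1 0 0 - key p u 0 0 0 0 0 0 0 0)
  have hsub : ∀ (a b : Sm) q, (a - b).1 q = a.1 q - b.1 q := fun _ _ _ => rfl
  have hadd : ∀ (a b : Sm) q, (a + b).1 q = a.1 q + b.1 q := fun _ _ _ => rfl
  have hmul : ∀ (a b : Sm) q, (a * b).1 q = a.1 q * b.1 q := fun _ _ _ => rfl
  have hneg : ∀ (a : Sm) q, (-a).1 q = -a.1 q := fun _ _ => rfl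
  have h2 : ∀ q, (2 : Sm).1 q = 2 := fun _ => rfl
  have h4 : ∀ q, (4 : Sm).1 q = 4 := fun _ => rfl
  have h0 : ∀ q, (0 : Sm).1 q = 0 := fun _ => rfl
  have h1 : ∀ q, (1 : Sm).1 q = 1 := fun _ => rfl
  have huu : ∀ q, uu.1 q = q.2 := fun _ => rfl
  have hco : ∀ i q, (co i).1 q = q.1 i := fun _ _ => rfl
  refine ⟨hU, ?_, ?_, ?_, ?_, ?_, ?_, ?_, ?_⟩
  · ext ⟨p, u⟩
    -- The second difference in u_x gives the coefficient of u_x².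
    simp only [h0]
    linear_combination (1 / 2) * (key p u 1 0 0 0 0 0 0 0 + key p u (-1) 0 0 0 0 0 0 0
      - 2 * key p u 0 0 0 0 0 0 0 0)
  · ext ⟨p, u⟩
    simp only [dHX_eq, dHY_eq, hsub, hadd, hmul, h2, h0, hco]
    exact hshear p u
  · ext ⟨p, u⟩
    simp only [dHX_eq, dHY_eq, hsub, hadd, hmul, h2, hco]
    exact hstretch p u
  · ext ⟨p, u⟩
    simp only [dHX_eq, map_add, map_sub, Derivation.leibniz, dX_co, smul_eq_mul, derivation_two]
    simp only [hsub, hadd, hmul, h2, h4, h0, h1, hco, reduceIte, Fin.reduceEq]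
    linear_combination (-1 / 2) * (key p u 0 0 0 0 1 0 0 0 - key p u 0 0 0 0 0 0 0 0)
      + 2 * p 0 * hshear p u
  · ext ⟨p, u⟩
    simp only [dHY_eq, map_add, map_sub, Derivation.leibniz, dX_co, smul_eq_mul, derivation_two]
    simp only [hsub, hadd, hmul, hneg, h2, h4, h0, h1, hco, reduceIte, Fin.reduceEq]
    linear_combination (-1 / 2) * (key p u 0 0 0 0 0 0 1 0 - key p u 0 0 0 0 0 0 0 0)
      - 2 * p 1 * hshear p u - 4 * p 0 * hstretch p u
  · ext ⟨p, u⟩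
    -- The odd part in u_x is its linear term; likewise for u_y next.
    simp only [lap, pow_two, dHX_eq, hsub, hadd, hmul, h2, h4, hco]
    linear_combination (-1 / 2) * (key p u 1 0 0 0 0 0 0 0 - key p u (-1) 0 0 0 0 0 0 0)
  · ext ⟨p, u⟩
    simp only [lap, pow_two, dHY_eq, hsub, hadd, hmul, h2, h4, hco]
    linear_combination (-1 / 2) * (key p u 0 1 0 0 0 0 0 0 - key p u 0 (-1) 0 0 0 0 0 0)
  · ext ⟨p, u⟩
    -- With all free derivatives zero, u_xx = -u remains and produces the terms with factor u.
    simp only [lap, pow_two, dHX_eq, hsub, hadd, hmul, h2, h4, h0, huu, hco]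
    linear_combination key p u 0 0 0 0 0 0 0 0

/-! ### Solution of the determining equations -/

lemma Sm.eq_of_natCast_mul {a b : Sm} (n : ℕ) (hn : n ≠ 0) (h : (n : Sm) * a = n * b) : a = b := by
  ext q
  have : (n : ℝ) * a.1 q = n * b.1 q := congrFun (congrArg Subtype.val h) q
  exact mul_left_cancel₀ (Nat.cast_ne_zero.2 hn) this

/-- The bracket of X and Y supplies the missing direction ∂_t. -/
lemma Sm.eq_const_of_frame (a : Sm) (hX : dHX a = 0) (hY : dHY a = 0) (hU : dU a = 0) :
    ∃ c : ℝ, a = algebraMap ℝ Sm c := by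
  have hT : dX 2 a = 0 := by
    refine Sm.eq_of_natCast_mul 4 (by norm_num) ?_
    have := dHX_dHY a
    rw [hX, hY, map_zero, map_zero] at this
    push_cast
    linear_combination this
  refine Sm.eq_const a (fun i => ?_) hU
  fin_cases i
  · simpa [dHX_eq, hT] using hX
  · simpa [dHY_eq, hT] using hY
  · exact hT

@[simp] lemma dHX_co_zero : dHX (co 0) = 1 := by simp [dHX_eq]
@[simp] lemma dHX_co_one : dHX (co 1) = 0 := by simp [dHX_eq]
@[simp] lemma dHY_co_zero : dHY (co 0) = 0 := by simp [dHY_eq]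
@[simp] lemma dHY_co_one : dHY (co 1) = 1 := by simp [dHY_eq]
@[simp] lemma dHX_uu : dHX uu = 0 := by simp [dHX_eq]
@[simp] lemma dHY_uu : dHY uu = 0 := by simp [dHY_eq]

/-- The coefficients of the vector field `a T + r R + b X̃ + c Ỹ`. -/
def killing (a r b c : ℝ) : Fin 3 → Sm :=
  ![algebraMap ℝ Sm r * co 1 + algebraMap ℝ Sm b, -(algebraMap ℝ Sm r * co 0) + algebraMap ℝ Sm c,
    algebraMap ℝ Sm a - 2 * algebraMap ℝ Sm b * co 1 + 2 * algebraMap ℝ Sm c * co 0]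

/-- The conformal factor k vanishes, because Δk = 2k and Δk = 0 both hold; ∂_t ξ⁰ and ∂_t ξ¹ are
multiples of derivatives of k. -/
lemma DeterminingEquations.dHX_xi_zero {ξ : Fin 3 → Sm} {η : Sm} (h : DeterminingEquations ξ η) :
    dHX (ξ 0) = 0 ∧ dX 2 (ξ 0) = 0 ∧ dX 2 (ξ 1) = 0 := by
  obtain ⟨hU, hUU, hsh, hst, hcX, hcY, hl0, hl1, hlη⟩ := h
  set f := ξ 2 - 2 * co 1 * ξ 0 + 2 * co 0 * ξ 1 with hf
  set k := dX 2 f with hk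
  set b := dU η with hb
  have c4 : ∀ (D : Derivation ℝ Sm Sm) (a : Sm), D (4 * a) = 4 * D a := fun D a => by simp
  have cn4 : ∀ (D : Derivation ℝ Sm Sm) (a : Sm), D (-4 * a) = -4 * D a := fun D a => by simp
  -- [X, Y] applied to the contact function f.
  have hk0 : k = 2 * dHX (ξ 0) := by
    refine Sm.eq_of_natCast_mul 4 (by norm_num) ?_
    have := dHX_dHY f
    rw [hcX, hcY, c4, cn4, ← hst] at this
    push_cast
    linear_combination this
  have hT1 : 4 * dX 2 (ξ 1) = dHX k := by rw [hk, dHX_dX_two, hcX, c4]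
  have hT0 : -4 * dX 2 (ξ 0) = dHY k := by rw [hk, dHY_dX_two, hcY, cn4]
  have c2 : ∀ (D : Derivation ℝ Sm Sm) (a : Sm), D (2 * a) = 2 * D a := fun D a => by simp
  have hXk : dHX k = 2 * dHX (dHX (ξ 0)) := by rw [hk0, c2]
  have hYk : dHY k = 2 * dHY (dHX (ξ 0)) := by rw [hk0, c2]
  have hsX : dHX (dHX (ξ 1)) + dHX (dHY (ξ 0)) = 0 := by rw [← map_add, hsh, map_zero]
  have hsY : dHY (dHX (ξ 1)) + dHY (dHY (ξ 0)) = 0 := by rw [← map_add, hsh, map_zero]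
  have hc0 := dHX_dHY (ξ 0)
  have hc1 := dHX_dHY (ξ 1)
  rw [← hst] at hc1
  rw [lap_eq] at hl0 hl1
  rw [← hst] at hl1
  -- The conformal equations and [X, Y] turn Δξ⁰ into -4 ∂_t ξ¹ = -Xk, to be compared with 2 Xb;
  -- similarly for Y below.
  have hbX : dHX (2 * b + k) = 0 := by
    rw [map_add, c2]
    linear_combination (-1) * hl0 + hsY - hT1 + hc1
  have hbY : dHY (2 * b + k) = 0 := by
    rw [map_add, c2]
    linear_combination (-1) * hl1 + hsX - hT0 - hc0
  have hUX : dU (dHX (ξ 0)) = 0 := by rw [← dHX_dU, hU, map_zero]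
  -- The u-derivative of the last determining equation.
  have hlb : lap b + k = 0 := by
    have := congrArg dU hlη
    simp only [map_add, map_sub, Derivation.leibniz, ← lap_dU, hUU, hUX, smul_eq_mul, dU_uu,
      derivation_two, map_zero] at this
    linear_combination this + hk0
  have hlk : lap k = 2 * k := by
    have : lap (2 * b + k) = 0 := by rw [lap_eq, hbX, hbY, map_zero, map_zero, add_zero]
    rw [lap_eq, map_add, map_add, map_add, map_add, c2, c2, c2, c2] at this
    rw [lap_eq] at hlb ⊢
    linear_combination this - 2 * hlb
  -- The function g measures the rotational part of ξ; its frame derivatives are expressed through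
  -- k.
  set g := 4 * dHX (ξ 1) with hg
  have hXg : dHX g = 6 * -dHY k := by
    rw [hg, c4]
    linear_combination 4 * hsX - 4 * hc0 + 2 * hYk - 4 * hT0
  have hYg : dHY g = 6 * dHX k := by
    rw [hg, c4]
    linear_combination (-4) * hc1 - 2 * hXk + 4 * hT1
  have hTgX : dX 2 g = dHX (dHX k) := by
    rw [hg, c4, ← dHX_dX_two, ← hT1, c4]
  have hTgY : dX 2 g = dHY (dHY k) := by
    have : g = -4 * dHY (ξ 0) := by rw [hg]; linear_combination 4 * hsh
    rw [this, cn4, ← dHY_dX_two, ← hT0, cn4]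
  have c6 : ∀ (D : Derivation ℝ Sm Sm) (a : Sm), D (6 * a) = 6 * D a := fun D a => by
    rw [Derivation.leibniz, show D 6 = 0 from mod_cast D.map_natCast 6]
    simp
  -- [X, Y]g equals 6 Δk by the frame derivatives of g and -4 ∂_t g = -2 Δk by `hTgX` and `hTgY`, so
  -- 8 Δk = 0. With Δk = 2k this is 16 k = 0.
  have hcg := dHX_dHY g
  rw [hXg, hYg, c6, c6, map_neg] at hcg
  have hk' : k = 0 := by
    refine Sm.eq_of_natCast_mul 16 (by norm_num) ?_
    rw [lap_eq] at hlk
    push_cast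
    linear_combination (-8) * hlk + hcg - 2 * hTgX - 2 * hTgY
  refine ⟨?_, ?_, ?_⟩
  · refine Sm.eq_of_natCast_mul 2 (by norm_num) ?_
    push_cast
    linear_combination hk' - hk0
  · refine Sm.eq_of_natCast_mul 4 (by norm_num) ?_
    rw [hk', map_zero] at hT0
    push_cast
    linear_combination -hT0
  · refine Sm.eq_of_natCast_mul 4 (by norm_num) ?_
    rw [hk', map_zero] at hT1
    push_cast
    linear_combination hT1

/-- The general solution of the determining equations. -/
lemma DeterminingEquations.exists_eq {ξ : Fin 3 → Sm} {η : Sm} (h : DeterminingEquations ξ η) :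
    ∃ (a r b c m : ℝ) (β : Sm), dU β = 0 ∧ lap β + β = 0 ∧ ξ = killing a r b c ∧
      η = algebraMap ℝ Sm m * uu + β := by
  obtain ⟨hX0, hT0, hT1⟩ := h.dHX_xi_zero
  obtain ⟨hU, hUU, hsh, hst, hcX, hcY, hl0, hl1, hlη⟩ := h
  have hX1Y : dHX (dHX (ξ 1)) = 0 := by
    have h1 : dHX (dHX (ξ 1)) + dHX (dHY (ξ 0)) = 0 := by rw [← map_add, hsh, map_zero]
    have h2 := dHX_dHY (ξ 0)
    rw [hX0, map_zero, hT0] at h2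
    linear_combination h1 - h2
  have hY1 : dHY (ξ 1) = 0 := hst ▸ hX0
  have hY1X : dHY (dHX (ξ 1)) = 0 := by
    have h2 := dHX_dHY (ξ 1)
    rw [hY1, map_zero, hT1] at h2
    linear_combination -h2
  obtain ⟨k, hk⟩ := Sm.eq_const_of_frame (dHX (ξ 1)) hX1Y hY1X (by rw [← dHX_dU, hU, map_zero])
  obtain ⟨c, hc⟩ := Sm.eq_const_of_frame (ξ 1 - algebraMap ℝ Sm k * co 0) (by simp [hk])
    (by simp [hY1]) (by simp [hU])
  have hY0 : dHY (ξ 0) = -algebraMap ℝ Sm k := by linear_combination hsh - hk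
  obtain ⟨b, hb⟩ := Sm.eq_const_of_frame (ξ 0 + algebraMap ℝ Sm k * co 1) (by simp [hX0])
    (by simp [hY0]) (by simp [hU])
  have hX2 : dHX (ξ 2) = 2 * algebraMap ℝ Sm c := by
    simp only [map_add, map_sub, Derivation.leibniz, smul_eq_mul, derivation_two, dHX_co_zero,
      dHX_co_one, hX0, hk] at hcX
    linear_combination hcX + 2 * hc
  have hY2 : dHY (ξ 2) = -2 * algebraMap ℝ Sm b := by
    simp only [map_add, map_sub, Derivation.leibniz, smul_eq_mul, derivation_two, dHY_co_zero,
      dHY_co_one, hY0, hY1] at hcY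
    linear_combination hcY - 2 * hb
  obtain ⟨a, ha⟩ := Sm.eq_const_of_frame
    (ξ 2 - 2 * algebraMap ℝ Sm c * co 0 + 2 * algebraMap ℝ Sm b * co 1)
    (by simp [hX2]) (by simp [hY2]; ring) (by simp [hU])
  have hX0' : lap (ξ 0) = 0 := by
    rw [lap_eq, hX0, map_zero, hY0, map_neg, Derivation.map_algebraMap]; simp
  have hX1' : lap (ξ 1) = 0 := by
    rw [lap_eq, hY1, map_zero, hk, Derivation.map_algebraMap]; simp
  obtain ⟨m, hm⟩ := Sm.eq_const_of_frame (dU η)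
    (Sm.eq_of_natCast_mul 2 (by norm_num) (by push_cast; rw [← hl0, hX0', mul_zero]))
    (Sm.eq_of_natCast_mul 2 (by norm_num) (by push_cast; rw [← hl1, hX1', mul_zero])) hUU
  -- The sign is due to R = y ∂_x - x ∂_y, whereas k is the slope of ξ¹ in x.
  refine ⟨a, -k, b, c, m, η - algebraMap ℝ Sm m * uu, by simp [hm], ?_, ?_, by ring⟩
  · have hlu : lap (η - algebraMap ℝ Sm m * uu) = lap η := by simp [lap_eq]
    rw [hlu]
    rw [hX0, hm] at hlη
    linear_combination hlη
  · funext l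
    fin_cases l
    · simp only [killing, map_neg, Fin.zero_eta, Matrix.cons_val_zero]
      linear_combination hb
    · simp only [killing, map_neg, Fin.mk_one, Matrix.cons_val_one, Matrix.cons_val_zero]
      linear_combination hc
    · simp only [killing, Fin.reduceFinMk, Matrix.cons_val]
      linear_combination ha

/-! ### The quadratic Lagrangian is not a divergence -/

open MeasureTheory Topology

/-- The infinite jet at `p` of the function `(x, y, t) ↦ c₀(x) c₁(y) c₂(t)`. -/
def prodJet (c : Fin 3 → ℝ → ℝ) (p : H1) : Jet :=
  (p, fun α => ∏ i, iteratedDeriv (α i) (c i) (p i))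

lemma contDiff_iteratedDeriv {f : ℝ → ℝ} (hf : ContDiff ℝ ∞ f) (n : ℕ) :
    ContDiff ℝ ∞ (iteratedDeriv n f) := by
  rw [iteratedDeriv_eq_iterate]
  exact hf.iterate_deriv n

lemma contDiff_comp_prodJet {c : Fin 3 → ℝ → ℝ} (hc : ∀ i, ContDiff ℝ ∞ (c i)) (G : DF) :
    ContDiff ℝ ∞ fun p => G.1 (prodJet c p) := by
  obtain ⟨A, g, hg, hgG⟩ := G.2
  simp only [hgG]
  refine hg.comp (contDiff_id.prodMk (contDiff_pi.2 fun α => ?_))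
  exact contDiff_prod (t := Finset.univ) (f := fun i (p : H1) => iteratedDeriv (α.1 i) (c i) (p i)) fun i _ =>
    (contDiff_iteratedDeriv (hc i) _).comp (contDiff_apply ℝ ℝ i)

lemma hasDerivAt_prodJet {c : Fin 3 → ℝ → ℝ} (hc : ∀ i, ContDiff ℝ ∞ (c i)) (p : H1) (i : Fin 3)
    (α : MultiIndex) :
    HasDerivAt (fun s => (prodJet c (Function.update p i s)).2 α) ((prodJet c p).2 (α + e i))
      (p i) := by
  have h : ∀ j n, HasDerivAt (iteratedDeriv n (c j)) (iteratedDeriv (n + 1) (c j) (p j)) (p j) := by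
    intro j n
    rw [iteratedDeriv_succ]
    exact ((contDiff_iteratedDeriv (hc j) n).differentiable (by simp) (p j)).hasDerivAt
  fin_cases i
  · simpa [prodJet, Fin.prod_univ_three, e] using
      ((h 0 (α 0)).mul_const (iteratedDeriv (α 1) (c 1) (p 1))).mul_const
        (iteratedDeriv (α 2) (c 2) (p 2))
  · simpa [prodJet, Fin.prod_univ_three, e] using
      ((h 1 (α 1)).const_mul (iteratedDeriv (α 0) (c 0) (p 0))).mul_const
        (iteratedDeriv (α 2) (c 2) (p 2))
  · simpa [prodJet, Fin.prod_univ_three, e] using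
      (h 2 (α 2)).const_mul
        (iteratedDeriv (α 0) (c 0) (p 0) * iteratedDeriv (α 1) (c 1) (p 1))

/-- The total derivative along the jet of a function is the partial derivative. -/
lemma totalD_prodJet {c : Fin 3 → ℝ → ℝ} (hc : ∀ i, ContDiff ℝ ∞ (c i)) (G : DF) (i : Fin 3)
    (p : H1) :
    totalD i G (prodJet c p) = fderiv ℝ (fun p => G.1 (prodJet c p)) p (Pi.single i 1) := by
  classical
  have hd := ((contDiff_comp_prodJet hc G).differentiable (by simp) p).hasFDerivAt
  have h1 := HasFDerivAt.comp_hasDerivAt_of_eq (p i) hd (hasDerivAt_update p i (p i)) (by simp)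
  obtain ⟨A, g, hg, hgG⟩ := G.2
  set z := prodJet c p with hz
  set Z : H1 × (A → ℝ) := (z.1, fun α => z.2 α) with hZ
  have hgd := (hg.differentiable (by simp) Z).hasFDerivAt
  have h2 : HasDerivAt (fun s => (Function.update p i s,
      fun α : A => (prodJet c (Function.update p i s)).2 α))
      ((Pi.single i 1 : H1), fun α : A => z.2 (α + e i)) (p i) :=
    (hasDerivAt_update p i (p i)).prodMk (hasDerivAt_pi.2 fun α => hasDerivAt_prodJet hc p i α)
  have h3 := HasFDerivAt.comp_hasDerivAt_of_eq (p i) hgd h2 (by simp [hZ, hz, prodJet])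
  have h4 : fderiv ℝ (fun p => G.1 (prodJet c p)) p (Pi.single i 1)
      = fderiv ℝ g Z (Pi.single i 1, fun α : A => z.2 (α + e i)) := by
    refine h1.unique (h3.congr_of_eventuallyEq (.of_forall fun s => ?_))
    exact hgG _
  have hx : jetDx i G z = fderiv ℝ g Z (Pi.single i 1, 0) := by
    refine HasDerivAt.deriv ?_
    have h5 : HasDerivAt (fun s => (Function.update z.1 i s, fun α : A => z.2 α))
        ((Pi.single i 1 : H1), (0 : A → ℝ)) (z.1 i) :=
      (hasDerivAt_update z.1 i (z.1 i)).prodMk (hasDerivAt_const _ _)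
    refine (HasFDerivAt.comp_hasDerivAt_of_eq (z.1 i) hgd h5 (by simp [hZ])).congr_of_eventuallyEq
      (.of_forall fun s => ?_)
    exact hgG _
  have hu : ∀ α : A, jetDu α G z = fderiv ℝ g Z (0, Pi.single α 1) := by
    intro α
    refine HasDerivAt.deriv ?_
    have h6 : HasDerivAt (fun s => fun β : A => Function.update z.2 (α : MultiIndex) s β)
        (Pi.single α (1 : ℝ)) (z.2 α) := by
      refine hasDerivAt_pi.2 fun β => ?_
      by_cases h : β = α
      · subst h
        simpa using hasDerivAt_id' (z.2 β)
      · have hne : (β : MultiIndex) ≠ α := fun h' => h (Subtype.ext h')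
        simpa [Function.update_of_ne hne, Pi.single_eq_of_ne h] using
          hasDerivAt_const (z.2 α) (z.2 β)
    have h5 : HasDerivAt (fun s => (z.1, fun β : A => Function.update z.2 (α : MultiIndex) s β))
        ((0 : H1), Pi.single α (1 : ℝ)) (z.2 α) := (hasDerivAt_const _ _).prodMk h6
    refine (HasFDerivAt.comp_hasDerivAt_of_eq (z.2 α) hgd h5 (by simp [hZ])).congr_of_eventuallyEq
      (.of_forall fun s => ?_)
    exact hgG _
  have hu0 : ∀ α ∉ A, jetDu α G z = 0 := by
    intro α hα
    have : (fun s => G.1 (z.1, Function.update z.2 α s)) = fun _ => G.1 z := by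
      funext s
      rw [hgG, hgG]
      congr 2
      funext β
      refine Function.update_of_ne ?_ _ _
      rintro rfl
      exact hα β.2
    simp [jetDu, this]
  -- Splitting the velocity of the jet curve into base and jet directions turns the chain rule into
  -- the formula for D_i.
  have hsum : ((Pi.single i 1 : H1), fun α : A => z.2 (α + e i))
      = ((Pi.single i 1 : H1), (0 : A → ℝ))
        + ∑ α : A, z.2 (α + e i) • ((0 : H1), (Pi.single α 1 : A → ℝ)) := by
    ext j
    · simp [Prod.fst_sum]
    · simp [Prod.snd_sum, Finset.sum_apply, Pi.single_apply]
  rw [h4, hsum, map_add, map_sum, totalD, hx,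
    finsum_eq_sum_of_support_subset (s := A) _ (fun α hα => by
      by_contra h
      exact hα (by simp [hu0 α h]))]
  congr 1
  rw [← Finset.sum_coe_sort]
  exact Finset.sum_congr rfl fun α _ => by rw [hu, map_smul, smul_eq_mul]

lemma iteratedDeriv_eq_zero_of_eventuallyEq {f : ℝ → ℝ} {s : ℝ} (h : f =ᶠ[𝓝 s] fun _ => 0) (n : ℕ) :
    iteratedDeriv n f s = 0 := by
  rw [h.iteratedDeriv_eq]
  simp

lemma prodJet_eq_of_eventuallyEq {c : Fin 3 → ℝ → ℝ} {p : H1} {i : Fin 3}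
    (h : c i =ᶠ[𝓝 (p i)] fun _ => 0) : prodJet c p = (p, 0) := by
  refine Prod.ext rfl (funext fun α => ?_)
  exact Finset.prod_eq_zero (f := fun i => iteratedDeriv (α i) (c i) (p i)) (Finset.mem_univ i)
    (iteratedDeriv_eq_zero_of_eventuallyEq h _)

/-- The integral of a divergence over a box depends on the boundary values only. -/
lemma exists_integral_divergence_eq (φ : Fin 3 → DF) :
    ∃ B : ℝ, ∀ c : Fin 3 → ℝ → ℝ, (∀ i, ContDiff ℝ ∞ (c i)) →
      (∀ i, c i =ᶠ[𝓝 (-3)] fun _ => 0) → (∀ i, c i =ᶠ[𝓝 3] fun _ => 0) →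
      ∫ p in Set.Icc (fun _ => -3 : H1) (fun _ => 3), ∑ i, totalD i (φ i) (prodJet c p) = B := by
  -- Near the faces of the box the jet is zero, so only φ at zero jets enters; these values need not
  -- vanish.
  refine ⟨∑ i : Fin 3, ((∫ x in Set.Icc ((fun _ => -3 : H1) ∘ Fin.succAbove i)
      ((fun _ => 3 : H1) ∘ Fin.succAbove i), (φ i).1 (Fin.insertNth i 3 x, 0)) -
      ∫ x in Set.Icc ((fun _ => -3 : H1) ∘ Fin.succAbove i) ((fun _ => 3 : H1) ∘ Fin.succAbove i),
        (φ i).1 (Fin.insertNth i (-3) x, 0)), fun c hc h1 h2 => ?_⟩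
  have hs := fun i => contDiff_comp_prodJet hc (φ i)
  simp only [totalD_prodJet hc]
  rw [integral_divergence_of_hasFDerivAt_off_countable' (fun _ => -3 : H1) (fun _ => 3)
    (fun _ => by norm_num) (fun i p => (φ i).1 (prodJet c p))
    (fun i => fderiv ℝ fun p => (φ i).1 (prodJet c p)) ∅ Set.countable_empty
    (fun i => (hs i).continuous.continuousOn)
    (fun x _ i => ((hs i).differentiable (by simp) x).hasFDerivAt)]
  · refine Finset.sum_congr rfl fun i _ => ?_
    congr 1
    · refine integral_congr_ae (.of_forall fun x => ?_)
      exact congrArg _ (prodJet_eq_of_eventuallyEq (i := i) (by simpa using h2 i))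
    · refine integral_congr_ae (.of_forall fun x => ?_)
      exact congrArg _ (prodJet_eq_of_eventuallyEq (i := i) (by simpa using h1 i))
  · refine (continuous_finsetSum _ fun i _ => ?_).continuousOn.integrableOn_compact isCompact_Icc
    exact ((hs i).continuous_fderiv (by simp)).clm_apply continuous_const

/-- Twice the Lagrangian `½ |∇u|² - ½ u²`. -/
def quadLagrangian (z : Jet) : ℝ :=
  z.2 (e 0) ^ 2 + z.2 (e 1) ^ 2 + 4 * (z.1 0 ^ 2 + z.1 1 ^ 2) * z.2 (e 2) ^ 2
    + 4 * z.1 1 * z.2 (e 0) * z.2 (e 2) - 4 * z.1 0 * z.2 (e 1) * z.2 (e 2) - z.2 0 ^ 2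

/-- With v = a(x)a(y)a(t), the cross terms of |∇(v cos x)|² and |∇(v sin x)|² cancel and |∇x|² = 1
leaves an extra v², while the zero-order terms of the three jets cancel. -/
lemma quadLagrangian_cos_add_sin {a : ℝ → ℝ} (ha : ContDiff ℝ ∞ a) (p : H1) :
    quadLagrangian (prodJet ![fun s => a s * Real.cos s, a, a] p)
      + quadLagrangian (prodJet ![fun s => a s * Real.sin s, a, a] p)
      - quadLagrangian (prodJet ![a, a, a] p) = (a (p 0) * a (p 1) * a (p 2)) ^ 2 := by
  have hd := (ha.differentiable (by simp) (p 0)).hasDerivAt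
  have h1 : deriv (fun s => a s * Real.cos s) (p 0)
      = deriv a (p 0) * Real.cos (p 0) + a (p 0) * -Real.sin (p 0) :=
    (hd.mul (Real.hasDerivAt_cos (p 0))).deriv
  have h2 : deriv (fun s => a s * Real.sin s) (p 0)
      = deriv a (p 0) * Real.sin (p 0) + a (p 0) * Real.cos (p 0) :=
    (hd.mul (Real.hasDerivAt_sin (p 0))).deriv
  simp only [quadLagrangian, prodJet, Fin.prod_univ_three, e, Pi.single_apply, Pi.zero_apply,
    Fin.reduceEq, reduceIte, iteratedDeriv_zero, iteratedDeriv_one, Matrix.cons_val, h1, h2]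
  have hcs := Real.sin_sq_add_cos_sq (p 0)
  set C := Real.cos (p 0)
  set S := Real.sin (p 0)
  set a0 := a (p 0)
  set a1 := a (p 1)
  set a2 := a (p 2)
  set b0 := deriv a (p 0)
  set b1 := deriv a (p 1)
  set b2 := deriv a (p 2)
  linear_combination ((b0 * a1 * a2) ^ 2 + (a0 * a1 * a2) ^ 2 + (a0 * b1 * a2) ^ 2
    + 4 * (p 0 ^ 2 + p 1 ^ 2) * (a0 * a1 * b2) ^ 2
    + 4 * p 1 * (b0 * a1 * a2) * (a0 * a1 * b2)
    - 4 * p 0 * (a0 * b1 * a2) * (a0 * a1 * b2) - (a0 * a1 * a2) ^ 2) * hcs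

/-- The quadratic Lagrangian is not a multiple of a total divergence. -/
lemma quadLagrangian_not_divergence (φ : Fin 3 → DF) :
    ¬ ∀ z, quadLagrangian z = ∑ i, totalD i (φ i) z := by
  intro h
  obtain ⟨B, hB⟩ := exists_integral_divergence_eq φ
  simp only [← h] at hB
  -- The zero function is admissible and determines the constant.
  have hB0 : B = 0 := by
    rw [← hB (fun _ _ => 0) (fun _ => contDiff_const) (fun _ => .rfl) (fun _ => .rfl)]
    have : ∀ p, prodJet (fun _ _ => 0) p = (p, 0) := fun p =>
      prodJet_eq_of_eventuallyEq (i := 0) .rfl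
    simp [this, quadLagrangian]
  subst hB0
  -- A bump supported in [-2, 2], hence zero near ±3.
  let a : ContDiffBump (0 : ℝ) := ⟨1, 2, one_pos, one_lt_two⟩
  have ha : ContDiff ℝ ∞ a := a.contDiff
  have ha0 : ∀ s, 2 ≤ |s| → a s = 0 := fun s hs => a.zero_of_le_dist (by simpa using hs)
  have hn : (a : ℝ → ℝ) =ᶠ[𝓝 (-3)] fun _ => 0 := by
    filter_upwards [Iio_mem_nhds (show (-3 : ℝ) < -2 by norm_num)] with s hs
    exact ha0 s (le_abs.2 (.inr (by linarith [Set.mem_Iio.1 hs])))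
  have hp : (a : ℝ → ℝ) =ᶠ[𝓝 3] fun _ => 0 := by
    filter_upwards [Ioi_mem_nhds (show (2 : ℝ) < 3 by norm_num)] with s hs
    exact ha0 s (le_abs.2 (.inl (le_of_lt hs)))
  have key : ∀ b : ℝ → ℝ, ContDiff ℝ ∞ b →
      ∫ p in Set.Icc (fun _ => -3 : H1) (fun _ => 3),
        quadLagrangian (prodJet ![fun s => a s * b s, a, a] p) = 0 := by
    intro b hb
    refine hB _ (fun i => ?_) (fun i => ?_) (fun i => ?_)
    · fin_cases i
      exacts [ha.mul hb, ha, ha]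
    · fin_cases i
      exacts [hn.mono fun s hs => by simp [hs], hn, hn]
    · fin_cases i
      exacts [hp.mono fun s hs => by simp [hs], hp, hp]
  have hcont : ∀ b : ℝ → ℝ, ContDiff ℝ ∞ b → IntegrableOn (fun p =>
      quadLagrangian (prodJet ![fun s => a s * b s, a, a] p))
      (Set.Icc (fun _ => -3 : H1) (fun _ => 3)) := by
    intro b hb
    have hc : ∀ i, ContDiff ℝ ∞ ((![fun s => a s * b s, a, a] : Fin 3 → ℝ → ℝ) i) := by
      intro i
      fin_cases i
      exacts [ha.mul hb, ha, ha]
    have hu : ∀ α, Continuous fun p => (prodJet ![fun s => a s * b s, a, a] p).2 α := fun α =>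
      (contDiff_comp_prodJet hc (jc α)).continuous
    have hx : ∀ i, Continuous fun p => (prodJet ![fun s => a s * b s, a, a] p).1 i := fun i =>
      continuous_apply i
    have : Continuous fun p => quadLagrangian (prodJet ![fun s => a s * b s, a, a] p) := by
      unfold quadLagrangian
      fun_prop
    exact this.continuousOn.integrableOn_compact isCompact_Icc
  have hsq : ∫ p in Set.Icc (fun _ => -3 : H1) (fun _ => 3), (a (p 0) * a (p 1) * a (p 2)) ^ 2 = 0 := by
    have hone : ∫ p in Set.Icc (fun _ => -3 : H1) (fun _ => 3),
        quadLagrangian (prodJet ![a, a, a] p) = 0 := by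
      simpa only [mul_one] using key (fun _ => 1) contDiff_const
    have hione : IntegrableOn (fun p => quadLagrangian (prodJet ![a, a, a] p))
        (Set.Icc (fun _ => -3 : H1) (fun _ => 3)) := by
      simpa only [mul_one] using hcont (fun _ => 1) contDiff_const
    simp only [← quadLagrangian_cos_add_sin ha]
    rw [integral_sub (f := fun p => quadLagrangian (prodJet ![fun s => a s * Real.cos s, a, a] p)
        + quadLagrangian (prodJet ![fun s => a s * Real.sin s, a, a] p))
        ((hcont _ Real.contDiff_cos).add (hcont _ Real.contDiff_sin)) hione,
      integral_add (hcont _ Real.contDiff_cos) (hcont _ Real.contDiff_sin),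
      key _ Real.contDiff_cos, key _ Real.contDiff_sin, hone]
    simp
  have hzero : ∀ p : H1, p ∉ Set.Icc (fun _ => -3 : H1) (fun _ => 3) →
      (a (p 0) * a (p 1) * a (p 2)) ^ 2 = 0 := by
    intro p hp
    have : ∃ i, 2 ≤ |p i| := by
      by_contra! hlt
      exact hp ⟨fun i => by linarith [(abs_lt.1 (hlt i)).1], fun i => by linarith [(abs_lt.1 (hlt i)).2]⟩
    obtain ⟨i, hi⟩ := this
    have := ha0 _ hi
    fin_cases i <;> simp_all
  rw [setIntegral_eq_integral_of_forall_compl_eq_zero hzero] at hsq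
  refine absurd hsq (ne_of_gt ?_)
  have hca : Continuous (a : ℝ → ℝ) := a.continuous
  refine Continuous.integral_pos_of_hasCompactSupport_nonneg_nonzero (x := 0) (by fun_prop)
    (HasCompactSupport.intro isCompact_Icc hzero) (fun p => sq_nonneg _) ?_
  have : a 0 = 1 := a.one_of_mem_closedBall (by simp [a])
  simp [this]

/-! ### Symmetry and Noether identities of the general solution -/

/-- The vector field `a T + r R + b X̃ + c Ỹ + m U + β ∂_u`. -/
def symField (a r b c m : ℝ) (β : Sm) : PointField :=
  pointField (killing a r b c) (algebraMap ℝ Sm m * uu + β)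

lemma killing_zero (a r b c : ℝ) :
    killing a r b c 0 = algebraMap ℝ Sm r * co 1 + algebraMap ℝ Sm b := rfl

lemma killing_one (a r b c : ℝ) :
    killing a r b c 1 = -(algebraMap ℝ Sm r * co 0) + algebraMap ℝ Sm c := rfl

lemma killing_two (a r b c : ℝ) : killing a r b c 2 = algebraMap ℝ Sm a
    - 2 * algebraMap ℝ Sm b * co 1 + 2 * algebraMap ℝ Sm c * co 0 := rfl

@[simp] lemma Sm.coe_algebraMap (c : ℝ) (q : H1 × ℝ) : (algebraMap ℝ Sm c).1 q = c := rfl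

@[simp] lemma Sm.coe_two (q : H1 × ℝ) : (2 : Sm).1 q = 2 := rfl

@[simp] lemma Sm.coe_four (q : H1 × ℝ) : (4 : Sm).1 q = 4 := rfl

lemma lap_apply (a : Sm) (q : H1 × ℝ) :
    (lap a).1 q = (dX 0 (dX 0 a)).1 q + (dX 1 (dX 1 a)).1 q
      + 4 * (q.1 0 ^ 2 + q.1 1 ^ 2) * (dX 2 (dX 2 a)).1 q
      + 4 * q.1 1 * (dX 0 (dX 2 a)).1 q - 4 * q.1 0 * (dX 1 (dX 2 a)).1 q := by
  simp [lap]

set_option maxHeartbeats 1600000 in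
-- Identically on jet space, S⁽²⁾(Δu + u) = m (Δu + u) + (Δβ + β).
lemma isLiePointSymmetry_symField (a r b c m : ℝ) {β : Sm} (hU : dU β = 0)
    (hβ : lap β + β = 0) :
    IsLiePointSymmetry 2 (klEquation fun u => u) (symField a r b c m β) := by
  refine ⟨contDiff_pointField _ _, fun z hz => ?_⟩
  have hq : (lap β + β).1 (z.1, z.2 0) = 0 := by rw [hβ]; rfl
  have hq' : (lap β).1 (z.1, z.2 0) + β.1 (z.1, z.2 0) = 0 := hq
  rw [lap_apply] at hq'
  rw [symField, extend_two_klEquation]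
  simp only [etaExt_pair, TD_etaOne, Fin.sum_univ_three, e_one_add_e_zero,
    e_two_add_e_zero, e_two_add_e_one, killing_zero, killing_one, killing_two, map_add, map_sub,
    map_neg, Derivation.leibniz, Derivation.map_algebraMap, dX_co, dU_co, dX_uu, dU_uu, hU,
    derivation_two, smul_eq_mul, map_zero, mul_zero, add_zero, zero_add]
  simp [klEquation] at hz hq' ⊢
  linear_combination m * hz + hq'

/-- The components of a divergence that is equal to `W_β⁽¹⁾ L`. -/
def potential (β : Sm) : Fin 3 → DF :=
  ![pt (dHX β * uu), pt (dHY β * uu), pt ((2 * co 1 * dHX β - 2 * co 0 * dHY β) * uu)]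

/-- The fields T, R, X̃, Ỹ are divergence-free and preserve the Lagrangian, U reproduces its
homogeneous quadratic part twice, and W_β gives div(u∇β) because Δβ = -β. As div ξ = 0, only F'
matters, not the constant in F. -/
lemma extend_one_symField {F : ℝ → ℝ} (hF : ∀ u : ℝ, HasDerivAt F u u) (a r b c m : ℝ) {β : Sm}
    (hU : dU β = 0) (hβ : lap β + β = 0) (z : Jet) :
    extend 1 (symField a r b c m β) (klLagrangian F) z
        + klLagrangian F z * ∑ i : Fin 3, totalD i (xi (symField a r b c m β) i) z
      = m * quadLagrangian z + ∑ i, totalD i (potential β i) z := by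
  have hq : (lap β + β).1 (z.1, z.2 0) = 0 := by rw [hβ]; rfl
  have hq' : (lap β).1 (z.1, z.2 0) + β.1 (z.1, z.2 0) = 0 := hq
  rw [lap_apply] at hq'
  have hη : ∀ ξ η, eta (pointField ξ η) z = η.1 (z.1, z.2 0) := fun _ _ => rfl
  rw [symField, extend_one]
  simp only [Fin.sum_univ_three, jetDx_zero_klLagrangian, jetDx_one_klLagrangian,
    jetDx_two_klLagrangian, jetDu_zero_klLagrangian z hF, jetDu_e0_klLagrangian,
    jetDu_e1_klLagrangian, jetDu_e2_klLagrangian, xi_pointField, pt_apply, hη,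
    etaExt_singleton, etaOne]
  simp only [potential, Matrix.cons_val, ← TD_apply, TD_pt]
  have hU' : ∀ i, dU (dX i β) = 0 := fun i => by rw [dU_dX, hU, map_zero]
  simp only [killing_zero, killing_one, killing_two, dHX_eq, dHY_eq, map_add, map_sub,
    map_neg, map_mul, Derivation.leibniz, Derivation.map_algebraMap, dX_co, dU_co, dX_uu, dU_uu, hU,
    hU', derivation_two, smul_eq_mul, map_zero, mul_zero, add_zero, zero_add,
    dX_comm 2 0 β, dX_comm 2 1 β]
  simp [quadLagrangian] at hq' ⊢
  linear_combination (-z.2 0) * hq'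

lemma eq_zero_of_isNoetherSymmetry_symField {F : ℝ → ℝ} (hF : ∀ u : ℝ, HasDerivAt F u u)
    {a r b c m : ℝ} {β : Sm} (hU : dU β = 0) (hβ : lap β + β = 0)
    (h : IsNoetherSymmetry 2 (klEquation fun u => u) 1 (klLagrangian F) (symField a r b c m β)) :
    m = 0 := by
  obtain ⟨-, φ, hφ, h⟩ := h
  by_contra hm
  let ψ : Fin 3 → DF := fun i => m⁻¹ • (⟨φ i, hφ i⟩ - potential β i)
  refine quadLagrangian_not_divergence ψ fun z => ?_
  have hz := (extend_one_symField hF a r b c m hU hβ z).symm.trans (h z)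
  have hψ : ∀ i, totalD i (ψ i) z = m⁻¹ * (totalD i (φ i) z - totalD i (potential β i) z) := by
    intro i
    rw [← TD_apply, Derivation.map_smul, map_sub]
    rfl
  simp only [hψ, ← Finset.mul_sum, Finset.sum_sub_distrib]
  rw [eq_inv_mul_iff_mul_eq₀ hm]
  linear_combination hz

/-- The Noether symmetries of `Δu + u = 0`. -/
lemma isNoetherSymmetry_iff {F : ℝ → ℝ} (hF : ∀ u : ℝ, HasDerivAt F u u) (S : PointField) :
    IsNoetherSymmetry 2 (klEquation fun u => u) 1 (klLagrangian F) S ↔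
      ∃ (a r b c : ℝ) (β : Sm), dU β = 0 ∧ lap β + β = 0 ∧ S = symField a r b c 0 β := by
  constructor
  · intro h
    obtain ⟨ξ, η, rfl⟩ := exists_eq_pointField h.1.1
    obtain ⟨a, r, b, c, m, β, hU, hβ, rfl, rfl⟩ := h.1.determiningEquations.exists_eq
    have hm : m = 0 := eq_zero_of_isNoetherSymmetry_symField hF hU hβ h
    subst hm
    exact ⟨a, r, b, c, β, hU, hβ, rfl⟩
  · rintro ⟨a, r, b, c, β, hU, hβ, rfl⟩
    refine ⟨isLiePointSymmetry_symField a r b c 0 hU hβ, fun i => potential β i,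
      fun i => (potential β i).2, fun z => ?_⟩
    rw [extend_one_symField hF a r b c 0 hU hβ, zero_mul, zero_add]

/-! ### Identification with the linear span -/

lemma pd_eq (i : Fin 3) (a : Sm) (u : ℝ) :
    pd i (fun p => a.1 (p, u)) = fun p => (dX i a).1 (p, u) :=
  funext fun p => (Sm.hasDerivAt_update a i p u).deriv

lemma kohnLaplacian_eq (a : Sm) (u : ℝ) (p : H1) :
    kohnLaplacian (fun p => a.1 (p, u)) p = (lap a).1 (p, u) := by
  simp only [kohnLaplacian, pd_eq, lap_apply]

lemma Sm.apply_eq_of_dU_eq_zero {a : Sm} (h : dU a = 0) (p : H1) (u v : ℝ) :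
    a.1 (p, u) = a.1 (p, v) := by
  have hd : ∀ s, HasDerivAt (fun s => a.1 (p, s)) 0 s := fun s => by
    simpa [h] using Sm.hasDerivAt_snd a p s
  exact is_const_of_deriv_eq_zero (fun s => (hd s).differentiableAt) (fun s => (hd s).deriv) u v

/-- Since β does not depend on u, the slice u = 0 is an arbitrary choice. -/
lemma symField_eq (a r b c : ℝ) {β : Sm} (hU : dU β = 0) :
    symField a r b c 0 β = a • fieldT + r • fieldR + b • fieldX + c • fieldY
      + fieldW fun p => β.1 (p, 0) := by
  funext q
  refine Prod.ext (funext fun l => ?_) ?_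
  · fin_cases l
    · simp [symField, pointField, killing, fieldT, fieldR, fieldX, fieldY, fieldW]
    · simp [symField, pointField, killing, fieldT, fieldR, fieldX, fieldY, fieldW]
    · simp [symField, pointField, killing, fieldT, fieldR, fieldX, fieldY, fieldW]
      ring
  · simp [symField, pointField, fieldT, fieldR, fieldX, fieldY, fieldW]
    exact Sm.apply_eq_of_dU_eq_zero hU _ _ _

/-- A smooth function on `H¹` as a function on `H¹ × ℝ`. -/
def lift (β : H1 → ℝ) (hβ : ContDiff ℝ ∞ β) : Sm :=
  ⟨fun q => β q.1, (hβ.comp contDiff_fst : ContDiff ℝ ∞ fun q : H1 × ℝ => β q.1)⟩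

lemma dU_lift (β : H1 → ℝ) (hβ : ContDiff ℝ ∞ β) : dU (lift β hβ) = 0 := by
  ext q
  exact (Sm.hasDerivAt_snd (lift β hβ) q.1 q.2).unique (hasDerivAt_const q.2 (β q.1))

lemma lap_lift (β : H1 → ℝ) (hβ : ContDiff ℝ ∞ β) (q : H1 × ℝ) :
    (lap (lift β hβ)).1 q = kohnLaplacian β q.1 :=
  (kohnLaplacian_eq (lift β hβ) q.2 q.1).symm

lemma mem_span_iff (S : PointField) :
    S ∈ Submodule.span ℝ (Gf ∪ linearW) ↔
      ∃ (a r b c : ℝ) (β : Sm), dU β = 0 ∧ lap β + β = 0 ∧ S = symField a r b c 0 β := by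
  constructor
  · intro h
    have h0 : dU (0 : Sm) = 0 := map_zero _
    have h0' : lap (0 : Sm) + 0 = 0 := by simp [lap]
    induction h using Submodule.span_induction with
    | mem S hS =>
      rcases hS with (rfl | rfl | rfl | rfl) | ⟨β, hs, hβ, rfl⟩
      · refine ⟨1, 0, 0, 0, 0, h0, h0', ?_⟩
        rw [symField_eq _ _ _ _ h0]
        simp; rfl
      · refine ⟨0, 1, 0, 0, 0, h0, h0', ?_⟩
        rw [symField_eq _ _ _ _ h0]
        simp; rfl
      · refine ⟨0, 0, 1, 0, 0, h0, h0', ?_⟩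
        rw [symField_eq _ _ _ _ h0]
        simp; rfl
      · refine ⟨0, 0, 0, 1, 0, h0, h0', ?_⟩
        rw [symField_eq _ _ _ _ h0]
        simp; rfl
      · refine ⟨0, 0, 0, 0, lift β hs, dU_lift β hs, ?_, ?_⟩
        · ext q
          exact (congrArg (· + β q.1) (lap_lift β hs q)).trans (hβ q.1)
        · rw [symField_eq _ _ _ _ (dU_lift β hs)]
          simp; rfl
    | zero =>
      refine ⟨0, 0, 0, 0, 0, h0, h0', ?_⟩
      rw [symField_eq _ _ _ _ h0]
      simp; rfl
    | add S S' _ _ hS hS' =>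
      obtain ⟨a, r, b, c, β, hU, hβ, rfl⟩ := hS
      obtain ⟨a', r', b', c', β', hU', hβ', rfl⟩ := hS'
      have hU'' : dU (β + β') = 0 := by rw [map_add, hU, hU', add_zero]
      refine ⟨a + a', r + r', b + b', c + c', β + β', hU'', ?_, ?_⟩
      · simp only [lap_eq, map_add] at hβ hβ' ⊢
        linear_combination hβ + hβ'
      · rw [symField_eq _ _ _ _ hU, symField_eq _ _ _ _ hU', symField_eq _ _ _ _ hU'']
        have : fieldW (fun p => (β + β').1 (p, 0))
            = fieldW (fun p => β.1 (p, 0)) + fieldW fun p => β'.1 (p, 0) := by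
          funext q
          exact Prod.ext (add_zero _).symm rfl
        rw [this]
        module
    | smul k S _ hS =>
      obtain ⟨a, r, b, c, β, hU, hβ, rfl⟩ := hS
      have hU' : dU (k • β) = 0 := by rw [Derivation.map_smul, hU, smul_zero]
      refine ⟨k * a, k * r, k * b, k * c, k • β, hU', ?_, ?_⟩
      · simp only [lap_eq, Derivation.map_smul] at hβ ⊢
        rw [← smul_add, ← smul_add, hβ, smul_zero]
      · rw [symField_eq _ _ _ _ hU, symField_eq _ _ _ _ hU']
        have : fieldW (fun p => (k • β).1 (p, 0)) = k • fieldW fun p => β.1 (p, 0) := by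
          funext q
          exact Prod.ext (smul_zero _).symm rfl
        rw [this]
        module
  · rintro ⟨a, r, b, c, β, hU, hβ, rfl⟩
    rw [symField_eq _ _ _ _ hU]
    have hG : ∀ S ∈ Gf, S ∈ Submodule.span ℝ (Gf ∪ linearW) := fun S hS =>
      Submodule.subset_span (.inl hS)
    refine add_mem (add_mem (add_mem (add_mem ?_ ?_) ?_) ?_) (Submodule.subset_span (.inr ?_))
    · exact Submodule.smul_mem _ _ (hG _ (by simp [Gf]))
    · exact Submodule.smul_mem _ _ (hG _ (by simp [Gf]))
    · exact Submodule.smul_mem _ _ (hG _ (by simp [Gf]))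
    · exact Submodule.smul_mem _ _ (hG _ (by simp [Gf]))
    · refine ⟨_, (Sm.contDiff β).comp (contDiff_id.prodMk contDiff_const), fun p => ?_, rfl⟩
      change kohnLaplacian (fun p => β.1 (p, 0)) p + β.1 (p, 0) = 0
      rw [kohnLaplacian_eq]
      exact congrFun (congrArg Subtype.val hβ) (p, 0)

/-! ### Lie brackets of the symmetries -/

/-- The derivative of a smooth function along a point vector field. -/
def along (ξ : Fin 3 → Sm) (η a : Sm) : Sm :=
  ξ 0 * dX 0 a + ξ 1 * dX 1 a + ξ 2 * dX 2 a + η * dU a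

lemma fderiv_pointField (ξ : Fin 3 → Sm) (η : Sm) (q v : H1 × ℝ) :
    fderiv ℝ (pointField ξ η) q v
      = (fun l => fderiv ℝ (ξ l : H1 × ℝ → ℝ) q v, fderiv ℝ (η : H1 × ℝ → ℝ) q v) := by
  have h : HasFDerivAt (pointField ξ η) ((ContinuousLinearMap.pi fun l =>
      fderiv ℝ (ξ l : H1 × ℝ → ℝ) q).prod (fderiv ℝ (η : H1 × ℝ → ℝ) q)) q :=
    (hasFDerivAt_pi.2 fun l => (Sm.differentiable (ξ l) q).hasFDerivAt).prodMk
      (Sm.differentiable η q).hasFDerivAt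
  rw [h.fderiv]
  rfl

lemma lieBracket_pointField (ξ ξ' : Fin 3 → Sm) (η η' : Sm) :
    VectorField.lieBracket ℝ (pointField ξ η) (pointField ξ' η')
      = pointField (fun l => along ξ η (ξ' l) - along ξ' η' (ξ l))
          (along ξ η η' - along ξ' η' η) := by
  funext q
  rw [VectorField.lieBracket, fderiv_pointField, fderiv_pointField]
  refine Prod.ext (funext fun l => ?_) ?_
  · simp [pointField, Sm.fderiv_apply, along]
  · simp [pointField, Sm.fderiv_apply, along]

lemma along_killing_zero (a r b c : ℝ) (β : Sm) : along (killing a r b c) 0 β =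
    (algebraMap ℝ Sm r * co 1 + algebraMap ℝ Sm b) * dX 0 β
      + (-(algebraMap ℝ Sm r * co 0) + algebraMap ℝ Sm c) * dX 1 β
      + (algebraMap ℝ Sm a - 2 * algebraMap ℝ Sm b * co 1 + 2 * algebraMap ℝ Sm c * co 0)
        * dX 2 β := by
  simp [along, killing_zero, killing_one, killing_two]

/-- The isometric fields of the Heisenberg group commute with the Kohn-Laplace operator. -/
lemma lap_along_killing (a r b c : ℝ) (β : Sm) :
    lap (along (killing a r b c) 0 β) = along (killing a r b c) 0 (lap β) := by
  have d4 : ∀ i, dX i (4 : Sm) = 0 := fun i => derivation_four _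
  simp only [along_killing_zero, lap, pow_two, map_add, map_sub, map_neg, Derivation.leibniz,
    Derivation.map_algebraMap, dX_co, smul_eq_mul, derivation_two, d4, dX_comm 1 0, dX_comm 2 0,
    dX_comm 2 1, Fin.reduceEq, reduceIte, map_zero, mul_zero, mul_one, add_zero, zero_add,
    neg_zero, sub_zero]
  ring

/-- The table is [X̃, Ỹ] = 4T, [R, X̃] = Ỹ, [Ỹ, R] = X̃ with T central; the fields W_β commute with
each other and are differentiated along the others. -/
lemma lieBracket_symField (a r b c a' r' b' c' : ℝ) {β β' : Sm} (hU : dU β = 0) (hU' : dU β' = 0) :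
    VectorField.lieBracket ℝ (symField a r b c 0 β) (symField a' r' b' c' 0 β')
      = symField (4 * (b * c' - b' * c)) 0 (c * r' - c' * r) (b' * r - b * r') 0
          (along (killing a r b c) 0 β' - along (killing a' r' b' c') 0 β) := by
  have h4 : algebraMap ℝ Sm 4 = 4 := rfl
  simp only [symField, lieBracket_pointField]
  congr 1
  · funext l
    fin_cases l <;>
    · simp [along, killing_zero, killing_one, killing_two, h4]
      ring
  · simp [along, hU, hU']

end KohnLaplace

end

theorem theorem3 (F : ℝ → ℝ) (hF : ∀ u : ℝ, HasDerivAt F u u) :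
    {S : KohnLaplace.PointField |
        KohnLaplace.IsNoetherSymmetry 2 (KohnLaplace.klEquation (fun u => u))
          1 (KohnLaplace.klLagrangian F) S}
      = (Submodule.span ℝ (KohnLaplace.Gf ∪ KohnLaplace.linearW) : Set KohnLaplace.PointField) ∧
    (∀ S S' : KohnLaplace.PointField,
      KohnLaplace.IsNoetherSymmetry 2 (KohnLaplace.klEquation (fun u => u))
          1 (KohnLaplace.klLagrangian F) S →
      KohnLaplace.IsNoetherSymmetry 2 (KohnLaplace.klEquation (fun u => u))
          1 (KohnLaplace.klLagrangian F) S' →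
      KohnLaplace.IsNoetherSymmetry 2 (KohnLaplace.klEquation (fun u => u))
          1 (KohnLaplace.klLagrangian F) (VectorField.lieBracket ℝ S S')) ∧
    KohnLaplace.IsLiePointSymmetry 2 (KohnLaplace.klEquation (fun u => u)) KohnLaplace.fieldU ∧
    ¬ KohnLaplace.IsNoetherSymmetry 2 (KohnLaplace.klEquation (fun u => u))
        1 (KohnLaplace.klLagrangian F) KohnLaplace.fieldU := by
  open KohnLaplace in
  have h0 : dU (0 : Sm) = 0 := map_zero _
  have h0' : lap (0 : Sm) + 0 = 0 := by simp [lap]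
  have hfU : fieldU = symField 0 0 0 0 1 0 := by
    funext q
    refine Prod.ext (funext fun l => ?_) ?_
    · fin_cases l <;> simp [fieldU, symField, pointField, killing]
    · simp [fieldU, symField, pointField]
  refine ⟨?_, ?_, ?_, ?_⟩
  · ext S
    exact (isNoetherSymmetry_iff hF S).trans (mem_span_iff S).symm
  · intro S S' hS hS'
    obtain ⟨a, r, b, c, β, hU, hβ, rfl⟩ := (isNoetherSymmetry_iff hF S).1 hS
    obtain ⟨a', r', b', c', β', hU', hβ', rfl⟩ := (isNoetherSymmetry_iff hF S').1 hS'
    rw [lieBracket_symField _ _ _ _ _ _ _ _ hU hU']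
    refine (isNoetherSymmetry_iff hF _).2 ⟨_, _, _, _, _, ?_, ?_, rfl⟩
    · simp [along_killing_zero, dU_dX, hU, hU']
    -- Derivatives of solutions along the four geometric fields are solutions, as these fields
    -- commute with Δ.
    · have hl : lap β = -β := eq_neg_of_add_eq_zero_left hβ
      have hl' : lap β' = -β' := eq_neg_of_add_eq_zero_left hβ'
      have hsub : ∀ x y : Sm, lap (x - y) = lap x - lap y := fun x y => by
        simp only [lap_eq, map_sub]
        ring
      rw [hsub, lap_along_killing, lap_along_killing, hl, hl']
      simp only [along, map_neg]
      ring
  · rw [hfU]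
    exact isLiePointSymmetry_symField 0 0 0 0 1 h0 h0'
  · rw [hfU]
    exact fun h => one_ne_zero (eq_zero_of_isNoetherSymmetry_symField hF h0 h0' h)
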